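/- Let $K$ be a connected compact semisimple Lie group with Lie algebra $\mathfrak k$, and let $K\to U(V)$ be an irreducible finite-dimensional unitary representation, with derived representation of $\mathfrak k$ on $V$. The momentum map of $\mathbb P=\mathbb P(V)$ is $$\mu:\mathbb P\to\mathfrak k^*,\qquad \mu[v](\xi)=\frac1i\,\frac{\langle \xi v,v\rangle}{\langle v,v\rangle}\qquad(\xi\in\mathfrak k).$$ Let $\mathfrak t\subset\mathfrak k$ be the Lie algebra of a Cartan subgroup (maximal torus) $T$, and let $W=N_K(T)/T$ be the Weyl group, acting on $\mathfrak t^*$. Weights $\nu$ and roots $\alpha$ are regarded as elements of $\mathfrak t^*$, so that $H\in\mathfrak t$ acts on the corresponding vectors of $V$ and of $\mathfrak k\otimes\mathbb C$ by $i\nu(H)$ and $i\alpha(H)$. Let $(\cdot|\cdot)$ be the inner product on $\mathfrak t^*$ induced by the negative of the Killing form of $\mathfrak k$, and regard $\mathfrak t^*$ as a subspace of $\mathfrak k^*$ by extending functionals by zero to the Killing-orthogonal complement of $\mathfrak t$. Fix a set $\Pi$ of simple roots (equivalently, a Borel subgroup containing $T$), and let $\mathfrak t^+=\{\nu\in\mathfrak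 t^*:(\nu|\alpha)\ge 0\ \ \forall\alpha\in\Pi\}$ be the positive Weyl chamber. Let $\lambda$ be the highest weight of $V$. Put $\lambda_\alpha=2(\alpha|\lambda)/(\alpha|\alpha)$ for $\alpha\in\Pi$, and let $\Pi_1$, $\Pi_0$, $\Pi^\lambda$ be the sets of $\alpha\in\Pi$ with $\lambda_\alpha=1$, $\lambda_\alpha=0$, $\lambda_\alpha\neq 0$ respectively. Let $\chi_0\in\mathfrak t^*$ be the element with $(\chi_0|\alpha)=\|\chi_0\|^2$ for $\alpha\in\Pi^\lambda$ and $(\chi_0|\beta)=0$ for $\beta\in\Pi_0$, where $\chi_0\ne0$ is required if $\Pi^\lambda\neq\emptyset$; this determines $\chi_0$ uniquely. Let $W_\lambda$ be the stabilizer of $\lambda$ in $W$, let $s_\alpha$ be the reflection of $\mathfrak t^*$ in the root $\alpha$, let $\mathrm{Cone}_\lambda(W\lambda)=\lambda+\mathrm{Cone}(W\lambda-\lambda)$ be the convex cone with vertex $\lambda$ generated by the rays $\lambda+\mathbb R_+(w\lambda-\lambda)$, $w\in W$, and let $$\Upsilon_\lambda=\{\nu\in\mathrm{Cone}_\lambda(W\lambda):(\nu|ws_\alpha\chi_0)\le(\lambda|ws_\alpha\chi_0)\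 \ \forall\alpha\in\Pi_1,\ \forall w\in W_\lambda\}.$$ Suppose that $\mu(\mathbb P)\cap\mathfrak t^+=\Upsilon_\lambda\cap\mathfrak t^+$. Then $$\mu(\mathbb P)\cap (W_\lambda\mathfrak t^+)=\Upsilon_\lambda\cap(W_\lambda\mathfrak t^+),$$ and the set $\mu(\mathbb P)\cap(W_\lambda\mathfrak t^+)$ is convex, where $W_\lambda\mathfrak t^+=\bigcup_{w\in W_\lambda}w\mathfrak t^+$. -/

import Mathlib

open scoped Manifold ContDiff TensorProduct LinearAlgebra.Projectivization

noncomputable section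

set_option linter.unusedSectionVars false

namespace MomentumCone

/-- Over the reals `minSmoothness ℝ 3` is `3`; so a smooth real Lie group has a Lie algebra. -/
instance instLEInftyMinSmoothness : ENat.LEInfty (minSmoothness ℝ 3) :=
  ⟨by
    rw [minSmoothness_of_isRCLikeNormedField]
    exact ENat.LEInfty.out⟩

instance instCompleteModel {E : Type*} [NormedAddCommGroup E] [NormedSpace ℝ E]
    [FiniteDimensional ℝ E] : CompleteSpace E := FiniteDimensional.complete ℝ E

variable {E : Type*} [NormedAddCommGroup E] [NormedSpace ℝ E] [FiniteDimensional ℝ E]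
variable {K : Type*} [TopologicalSpace K] [ChartedSpace E K] [Group K] [LieGroup 𝓘(ℝ, E) ∞ K]
variable {V : Type*} [NormedAddCommGroup V] [InnerProductSpace ℂ V] [FiniteDimensional ℂ V]

/-! ### The group, its Lie algebra and the Weyl group -/

variable (E K) in
/-- The Lie algebra `𝔨` of the real Lie group `K`. -/
abbrev LieAlg : Type _ := GroupLieAlgebra 𝓘(ℝ, E) K

variable (E) in
/-- The adjoint representation: `Ad k` is the derivative at `1` of `g ↦ k g k⁻¹`. -/
def Ad (k : K) (X : LieAlg E K) : LieAlg E K :=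
  (mfderiv 𝓘(ℝ, E) 𝓘(ℝ, E) (fun g : K => k * g * k⁻¹) 1 : E →L[ℝ] E) X

lemma contMDiff_conj (k : K) :
    ContMDiff 𝓘(ℝ, E) 𝓘(ℝ, E) ∞ (fun g : K => k * g * k⁻¹) :=
  (contMDiff_const.mul contMDiff_id).mul contMDiff_const

lemma Ad_one (X : LieAlg E K) : Ad E (1 : K) X = X := by
  have h : (fun g : K => 1 * g * (1 : K)⁻¹) = id := by
    funext g
    simp
  unfold Ad
  rw [h]
  exact congrArg (fun f : E →L[ℝ] E => f X) (mfderiv_id (I := 𝓘(ℝ, E)) (x := (1 : K)))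

lemma Ad_mul (k l : K) (X : LieAlg E K) : Ad E (k * l) X = Ad E k (Ad E l X) := by
  have h : (fun g : K => k * l * g * (k * l)⁻¹)
      = (fun g : K => k * g * k⁻¹) ∘ (fun g : K => l * g * l⁻¹) := by
    funext g
    simp [mul_assoc]
  have hc := mfderiv_comp (I := 𝓘(ℝ, E)) (I' := 𝓘(ℝ, E)) (I'' := 𝓘(ℝ, E)) (1 : K)
    (((contMDiff_conj (E := E) k).mdifferentiable (by simp)) (l * 1 * l⁻¹))
    (((contMDiff_conj (E := E) l).mdifferentiable (by simp)) 1)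
  have h1 : l * 1 * l⁻¹ = 1 := by simp
  unfold Ad
  rw [h]
  refine (congrArg (fun f : E →L[ℝ] E => f X) hc).trans ?_
  change (mfderiv 𝓘(ℝ, E) 𝓘(ℝ, E) (fun g : K => k * g * k⁻¹) (l * 1 * l⁻¹) : E →L[ℝ] E) _ = _
  rw [h1]
  rfl

/-- `𝔱` is a maximal abelian subalgebra of `𝔨`, i.e. the Lie algebra of a Cartan subgroup
(maximal torus) of the compact connected group `K`. -/
def IsCartan (𝔱 : LieSubalgebra ℝ (LieAlg E K)) : Prop :=
  Maximal (fun 𝔰 : LieSubalgebra ℝ (LieAlg E K) => IsLieAbelian 𝔰) 𝔱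

variable (𝔱 : LieSubalgebra ℝ (LieAlg E K))

/-- The dual space `𝔱*`. -/
abbrev TDual : Type _ := Module.Dual ℝ 𝔱

/-- The Weyl group `W = N_K(T) / T`, as the group of all automorphisms of `𝔱` that are restrictions
of `Ad k` for some `k ∈ K` preserving `𝔱`. -/
def weylGroup : Subgroup (𝔱 ≃ₗ[ℝ] 𝔱) where
  carrier := {w | ∃ k : K, ∀ H : 𝔱, ((w H : 𝔱) : LieAlg E K) = Ad E k H}
  mul_mem' := by
    rintro w w' ⟨k, hk⟩ ⟨k', hk'⟩
    refine ⟨k * k', fun H => ?_⟩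
    rw [Ad_mul, ← hk', ← hk]
    rfl
  one_mem' := ⟨1, fun H => (Ad_one _).symm⟩
  inv_mem' := by
    rintro w ⟨k, hk⟩
    refine ⟨k⁻¹, fun H => ?_⟩
    have h : w (w⁻¹ H) = H := w.apply_symm_apply H
    have h2 := hk (w⁻¹ H)
    rw [h] at h2
    rw [h2, ← Ad_mul, inv_mul_cancel, Ad_one]

variable {𝔱}

/-- The action of `W` on `𝔱*`: `(w ν)(H) = ν (w⁻¹ H)`. -/
def coact (w : 𝔱 ≃ₗ[ℝ] 𝔱) (ν : TDual 𝔱) : TDual 𝔱 := ν ∘ₗ (w.symm : 𝔱 →ₗ[ℝ] 𝔱)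

/-! ### The Killing form and the inclusion of `𝔱*` in `𝔨*` -/

/-- The element of `𝔱` that represents `ν ∈ 𝔱*` by the negative of the Killing form of `𝔨`: the
`X ∈ 𝔱` with `-(X | H) = ν H` for all `H ∈ 𝔱`. For `K` compact semisimple the Killing form is
negative definite on `𝔱`, so there is exactly one such `X`. -/
def sharp : TDual 𝔱 → 𝔱 :=
  Function.invFun fun X : 𝔱 => (-(killingForm ℝ (LieAlg E K) (X : LieAlg E K)).comp
    (𝔱 : Submodule ℝ (LieAlg E K)).subtype : TDual 𝔱)

/-- The inner product `(ν | ν')` on `𝔱*`, induced by the Killing form. The real functional `ν` stands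
for the complex functional `i ν` (e.g. a weight or a root), which makes this form positive. -/
def ip (ν ν' : TDual 𝔱) : ℝ := ν' (sharp ν)

/-- The inclusion `𝔱* ⊆ 𝔨*` under the identifications `𝔱 ≅ 𝔱*` and `𝔨 ≅ 𝔨*` given by the Killing
form: `ν` is extended by zero to the orthogonal complement of `𝔱`. -/
def incl (ν : TDual 𝔱) : Module.Dual ℝ (LieAlg E K) :=
  -(killingForm ℝ (LieAlg E K) (sharp ν : LieAlg E K))

/-! ### Roots, simple roots, the Weyl chamber -/

/-- The real roots `α ∈ 𝔱*`: `α ≠ 0` and some `Z ≠ 0` in the complexification of `𝔨` has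
`[H, Z] = i α(H) Z` for all `H ∈ 𝔱`. -/
def IsRoot (α : TDual 𝔱) : Prop :=
  α ≠ 0 ∧ ∃ Z : ℂ ⊗[ℝ] LieAlg E K, Z ≠ 0 ∧
    ∀ H : 𝔱, ⁅(1 : ℂ) ⊗ₜ[ℝ] (H : LieAlg E K), Z⁆ = (Complex.I * (α H : ℂ)) • Z

/-- `S` is a set of simple roots: a linearly independent set of roots such that each root or its
negative is a sum of elements of `S`. These sets correspond to the Borel subgroups containing `T`,
and to the Weyl chambers. -/
structure IsSimpleSystem (S : Set (TDual 𝔱)) : Prop where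
  isRoot : ∀ α ∈ S, IsRoot α
  linearIndependent : LinearIndepOn ℝ id S
  pos_or_neg : ∀ α : TDual 𝔱, IsRoot α →
    α ∈ AddSubmonoid.closure S ∨ -α ∈ AddSubmonoid.closure S

/-- The positive Weyl chamber `𝔱⁺`, as a subset of `𝔱*`. -/
def chamber (S : Set (TDual 𝔱)) : Set (TDual 𝔱) := {ν | ∀ α ∈ S, 0 ≤ ip ν α}

/-- The reflection `s_α` of `𝔱*`. -/
def refl (α ν : TDual 𝔱) : TDual 𝔱 := ν - (2 * ip ν α / ip α α) • α

/-- The coefficient `λ_α` of the fundamental weight `ω_α` in `lam`. -/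
def coeff (lam α : TDual 𝔱) : ℝ := 2 * ip α lam / ip α α

/-! ### Unitary representations, weights, the momentum map -/

/-- The operator on `V` by which `k ∈ K` acts, as a continuous linear map. -/
def repOp (ρ : Representation ℂ K V) (k : K) : V →L[ℂ] V := LinearMap.toContinuousLinearMap (ρ k)

variable (E) in
/-- `ρ` is a smooth unitary representation of `K`. -/
structure IsUnitaryRep (ρ : Representation ℂ K V) : Prop where
  smooth : ContMDiff 𝓘(ℝ, E) 𝓘(ℝ, V →L[ℂ] V) ∞ (repOp ρ)
  unitary : ∀ (k : K) (v v' : V), inner ℂ (ρ k v) (ρ k v') = inner ℂ v v'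

variable (E) in
/-- The derived representation of `𝔨` on `V`. -/
def dRep (ρ : Representation ℂ K V) : LieAlg E K →ₗ[ℝ] (V →L[ℂ] V) :=
  let D : E →L[ℝ] (V →L[ℂ] V) := mfderiv 𝓘(ℝ, E) 𝓘(ℝ, V →L[ℂ] V) (repOp ρ) 1
  D.toLinearMap

/-- `ν ∈ 𝔱*` is a weight of `V`: some `v ≠ 0` has `H v = i ν(H) v` for all `H ∈ 𝔱`. -/
def IsWeight (ρ : Representation ℂ K V) (ν : TDual 𝔱) : Prop :=
  ∃ v : V, v ≠ 0 ∧ ∀ H : 𝔱, dRep E ρ H v = (Complex.I * (ν H : ℂ)) • v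

/-- `lam` is the highest weight of `V`: it is a weight, and every other weight is obtained from it
by subtracting simple roots. -/
def IsHighestWeight (ρ : Representation ℂ K V) (S : Set (TDual 𝔱)) (lam : TDual 𝔱) : Prop :=
  IsWeight ρ lam ∧ ∀ ν : TDual 𝔱, IsWeight ρ ν → lam - ν ∈ AddSubmonoid.closure S

variable (E) in
/-- For `v : V` the functional `ξ ↦ (1/i) ⟨ξ v, v⟩ / ⟨v, v⟩` on `𝔨`. The quotient is real if `ρ` is
unitary. In Mathlib `inner ℂ x y` is linear in `y`, so `⟨ξ v, v⟩` is `inner ℂ v (ξ v)`. -/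
def momentumVec (ρ : Representation ℂ K V) (v : V) : Module.Dual ℝ (LieAlg E K) where
  toFun ξ := (1 / Complex.I * (inner ℂ v (dRep E ρ ξ v) / inner ℂ v v)).re
  map_add' ξ η := by
    rw [map_add, add_apply, inner_add_right, add_div, mul_add, Complex.add_re]
  map_smul' c ξ := by
    rw [map_smul, smul_apply, ← Complex.coe_smul, inner_smul_right,
      mul_div_assoc, mul_left_comm, Complex.re_ofReal_mul]
    rfl

variable (E) in
/-- The momentum map `μ : ℙ(V) → 𝔨*`, `μ[v](ξ) = (1/i) ⟨ξ v, v⟩ / ⟨v, v⟩`. -/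
def momentum (ρ : Representation ℂ K V) : ℙ ℂ V → Module.Dual ℝ (LieAlg E K) :=
  Projectivization.lift (fun v : {v : V // v ≠ 0} => momentumVec E ρ v) (by
    rintro ⟨a, ha⟩ ⟨b, hb⟩ t (rfl : a = t • b)
    have ht : t ≠ 0 := fun h => ha (by rw [h, zero_smul])
    have ht' : (starRingEnd ℂ) t ≠ 0 := (map_ne_zero _).2 ht
    ext ξ
    change (1 / Complex.I * (inner ℂ (t • b) (dRep E ρ ξ (t • b)) / inner ℂ (t • b) (t • b))).re
      = (1 / Complex.I * (inner ℂ b (dRep E ρ ξ b) / inner ℂ b b)).re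
    rw [map_smul, inner_smul_left, inner_smul_left, inner_smul_right, inner_smul_right,
      mul_div_mul_left _ _ ht', mul_div_mul_left _ _ ht])

/-! ### The cone `Υ_λ` -/

/-- `Cone_a(A) = a + Cone(A - a)`: the affine convex cone with vertex `a` generated by the rays from
`a` through the points of `A`. -/
def coneAt {M : Type*} [AddCommGroup M] [Module ℝ M] (a : M) (A : Set M) : Set M :=
  {x | x - a ∈ PointedCone.hull ℝ ((fun y => y - a) '' A)}

/-- The orbit `W lam`. -/
def weylOrbit (lam : TDual 𝔱) : Set (TDual 𝔱) := {ν | ∃ w ∈ weylGroup 𝔱, ν = coact w lam}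

/-- The stabilizer `W_λ` of `lam` in `W`. -/
def weylStab (lam : TDual 𝔱) : Set (𝔱 ≃ₗ[ℝ] 𝔱) := {w | w ∈ weylGroup 𝔱 ∧ coact w lam = lam}

/-- `W_λ 𝔱⁺`: the union of the Weyl chambers `w 𝔱⁺` for `w ∈ W_λ`. -/
def stabChamber (S : Set (TDual 𝔱)) (lam : TDual 𝔱) : Set (TDual 𝔱) :=
  {ν | ∃ w ∈ weylStab lam, ∃ ν' ∈ chamber S, ν = coact w ν'}

/-- `χ₀` is the element with `(χ₀ | α) = ‖χ₀‖²` for the simple roots `α` with `λ_α ≠ 0`, and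
`(χ₀ | β) = 0` for the simple roots `β` with `λ_β = 0`. If some `λ_α` is nonzero, these equations
have exactly two solutions, `0` and a nonzero one, and `χ₀` is the nonzero one. -/
structure IsChiZero (S : Set (TDual 𝔱)) (lam χ₀ : TDual 𝔱) : Prop where
  eq_sq : ∀ α ∈ S, coeff lam α ≠ 0 → ip χ₀ α = ip χ₀ χ₀
  eq_zero : ∀ β ∈ S, coeff lam β = 0 → ip χ₀ β = 0
  ne_zero : (∃ α ∈ S, coeff lam α ≠ 0) → χ₀ ≠ 0

/-- The cone `Υ_λ`: the `ν ∈ Cone_λ(W lam)` with `(ν | w s_α χ₀) ≤ (lam | w s_α χ₀)` for all simple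
roots `α` with `λ_α = 1` and all `w ∈ W_λ`. -/
def upsilon (S : Set (TDual 𝔱)) (lam χ₀ : TDual 𝔱) : Set (TDual 𝔱) :=
  {ν | ν ∈ coneAt lam (weylOrbit lam) ∧ ∀ α ∈ S, coeff lam α = 1 → ∀ w ∈ weylStab lam,
    ip ν (coact w (refl α χ₀)) ≤ ip lam (coact w (refl α χ₀))}

end MomentumCone

end

open scoped Manifold ContDiff TensorProduct LinearAlgebra.Projectivization

noncomputable section

set_option linter.unusedSectionVars false

namespace MomentumCone

/-! The equality is a symmetry argument. The image of `μ` is `Ad`-invariant, so membership of `ν ∈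
𝔱*` in it is invariant under `W` (`incl_coact_mem_range_momentum`). The set `Υ_λ` is invariant under
`W_λ`, which fixes `λ` and permutes the generating rays and the inequalities (`coact_mem_upsilon`).
The known equality on `𝔱⁺` is therefore carried by `W_λ` to all of `W_λ 𝔱⁺`.

For convexity, `Υ_λ` is an intersection of a cone and half-spaces, so the point is that `W_λ 𝔱⁺` is
convex. By `mem_stabChamber_iff` it is the set of `ν` with `(ν|α) ≥ 0` for every root `α` with
`(λ|α) > 0`. Given such a `ν`, choose `w ∈ W_λ` maximizing `wν` at a point where all simple roots
equal `1`; if `wν` were negative on a simple `β` orthogonal to `λ`, the reflection `s_β ∈ W_λ` would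
increase the value.

This, and the dominance of `λ`, require root reflections to lie in `W`, which is here defined
through `Ad K`. For a root vector `A + iB`, the half turn generated by `ad A` negates the vector
dual to `α` and fixes `ker α` (`exists_Ad_neg_sharp`). It belongs to `Ad K` because the derivative
of `Ad` is `ad` (`exists_curve_adOp`) and `Ad K` is compact, hence contains `exp (ad A)` as a limit
of powers (`exists_adOp_eq_exp`). Signs come from the negative definite Killing form
(`killingForm_self_neg`). -/

variable {E : Type*} [NormedAddCommGroup E] [NormedSpace ℝ E] [FiniteDimensional ℝ E]
variable {K : Type*} [TopologicalSpace K] [ChartedSpace E K] [Group K] [LieGroup 𝓘(ℝ, E) ∞ K]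

/-! ### The adjoint representation: smoothness and compatibility with the bracket -/

section AdjointRepresentation

open VectorField Filter Topology

variable (E) in
/-- The operator `Ad k`, as a continuous linear endomorphism of the model space. -/
def adOp (k : K) : E →L[ℝ] E := mfderiv 𝓘(ℝ, E) 𝓘(ℝ, E) (fun g : K => k * g * k⁻¹) 1

lemma adOp_one : adOp E (1 : K) = 1 := ContinuousLinearMap.ext (Ad_one (E := E) (K := K))

lemma adOp_mul (k l : K) : adOp E (k * l) = adOp E k * adOp E l :=
  ContinuousLinearMap.ext (Ad_mul (E := E) k l)

lemma adOp_pow (k : K) (n : ℕ) : adOp E (k ^ n) = adOp E k ^ n := by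
  induction n with
  | zero => simp [adOp_one]
  | succ n ih => rw [pow_succ, pow_succ, adOp_mul, ih]

/-- The derivative of a smooth family is smooth when read in tangent coordinates. Every conjugation
fixes `1`, so those coordinate changes are all trivial here. -/
lemma contMDiff_adOp : ContMDiff 𝓘(ℝ, E) 𝓘(ℝ, E →L[ℝ] E) ∞ (adOp E : K → E →L[ℝ] E) := by
  intro k₀
  have hf : ContMDiff (𝓘(ℝ, E).prod 𝓘(ℝ, E)) 𝓘(ℝ, E) ∞
      (Function.uncurry fun k g : K => k * g * k⁻¹) :=
    (contMDiff_fst.mul contMDiff_snd).mul contMDiff_fst.inv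
  have h := ContMDiffAt.mfderiv (m := ∞) (n := ∞) (x₀ := k₀) (fun k g : K => k * g * k⁻¹)
    (fun _ : K => (1 : K)) hf.contMDiffAt contMDiffAt_const (by simp)
  refine h.congr_of_eventuallyEq (Eventually.of_forall fun k => ?_)
  have h1 : k * 1 * k⁻¹ = 1 := by simp
  have h2 : k₀ * 1 * k₀⁻¹ = 1 := by simp
  have aux : ∀ z z' : K, z = 1 → z' = 1 → ∀ v : E,
      (tangentBundleCore 𝓘(ℝ, E) K).coordChange (achart E z) (achart E z') z v = v := by
    rintro z z' rfl rfl v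
    exact (tangentBundleCore 𝓘(ℝ, E) K).coordChange_self _ _ (by simp) v
  have h3 := inTangentCoordinates_eq (I := 𝓘(ℝ, E)) (I' := 𝓘(ℝ, E)) (x₀ := k₀) (x := k)
    (fun _ : K => (1 : K)) (fun x : K => x * 1 * x⁻¹) (fun x => adOp E x) (by simp) (by simp)
  refine Eq.symm (Eq.trans h3 (ContinuousLinearMap.ext fun v => ?_))
  exact (aux _ _ h1 h2 _).trans (congrArg (adOp E k) (aux _ _ rfl rfl v))

lemma continuous_adOp : Continuous (adOp E : K → E →L[ℝ] E) :=
  contMDiff_adOp.continuous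

lemma mdifferentiable_conj (k : K) :
    MDifferentiable 𝓘(ℝ, E) 𝓘(ℝ, E) (fun g : K => k * g * k⁻¹) :=
  (contMDiff_conj k).mdifferentiable (by simp)

lemma mdifferentiable_mul_left (k : K) :
    MDifferentiable 𝓘(ℝ, E) 𝓘(ℝ, E) (fun g : K => k * g) :=
  (contMDiff_const.mul contMDiff_id : ContMDiff 𝓘(ℝ, E) 𝓘(ℝ, E) ∞ _).mdifferentiable (by simp)

lemma mdifferentiable_mul_right (k : K) :
    MDifferentiable 𝓘(ℝ, E) 𝓘(ℝ, E) (fun g : K => g * k) :=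
  (contMDiff_id.mul contMDiff_const : ContMDiff 𝓘(ℝ, E) 𝓘(ℝ, E) ∞ _).mdifferentiable (by simp)

variable (E) in
/-- The derivative of a self-map of `K`, as an endomorphism of the model space. -/
def derivMap (f : K → K) (x : K) : E →L[ℝ] E := mfderiv 𝓘(ℝ, E) 𝓘(ℝ, E) f x

lemma derivMap_comp {f g : K → K} (hf : MDifferentiable 𝓘(ℝ, E) 𝓘(ℝ, E) f)
    (hg : MDifferentiable 𝓘(ℝ, E) 𝓘(ℝ, E) g) (x : K) :
    derivMap E (fun y => f (g y)) x = derivMap E f (g x) ∘L derivMap E g x :=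
  mfderiv_comp x (hf _) (hg _)

lemma derivMap_id (x : K) : derivMap E (fun y : K => y) x = ContinuousLinearMap.id ℝ E :=
  mfderiv_id

lemma inverse_derivMap_conj (k g : K) :
    (derivMap E (fun x : K => k * x * k⁻¹) g).inverse =
      derivMap E (fun x : K => k⁻¹ * x * k⁻¹⁻¹) (k * g * k⁻¹) := by
  have A := derivMap_comp (E := E) (mdifferentiable_conj k⁻¹) (mdifferentiable_conj k) g
  have B := derivMap_comp (E := E) (mdifferentiable_conj k) (mdifferentiable_conj k⁻¹) (k * g * k⁻¹)
  simp only [inv_inv, mul_assoc, inv_mul_cancel_left, mul_inv_cancel_left, inv_mul_cancel,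
    mul_inv_cancel, mul_one, derivMap_id] at A B ⊢
  exact ContinuousLinearMap.inverse_eq B.symm A.symm

/-- Differentiate `k⁻¹ ((k g k⁻¹)(k x k⁻¹)) k = g x` at `x = 1`. -/
lemma mpullback_conj_mulInvariantVectorField (k : K) (X : LieAlg E K) :
    mpullback 𝓘(ℝ, E) 𝓘(ℝ, E) (fun x : K => k * x * k⁻¹)
      (mulInvariantVectorField (Ad E k X)) = mulInvariantVectorField X := by
  funext g
  change (derivMap E (fun x : K => k * x * k⁻¹) g).inverse
    (derivMap E (fun x => k * g * k⁻¹ * x) 1 (derivMap E (fun x => k * x * k⁻¹) 1 X))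
    = derivMap E (fun x => g * x) 1 X
  have A := derivMap_comp (E := E) (mdifferentiable_conj k⁻¹)
    ((mdifferentiable_mul_left (k * g * k⁻¹)).comp (mdifferentiable_conj k)) 1
  have B := derivMap_comp (E := E) (mdifferentiable_mul_left (k * g * k⁻¹))
    (mdifferentiable_conj k) 1
  rw [inverse_derivMap_conj]
  simp only [Function.comp_def, inv_inv, mul_assoc, inv_mul_cancel_left, inv_mul_cancel,
    mul_inv_cancel, mul_one, one_mul] at A B ⊢
  rw [A, B]
  rfl

/-- Pullback along conjugation commutes with brackets of vector fields and sends the invariant field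
of `Ad k X` to that of `X`. -/
lemma Ad_lie (k : K) (X Y : LieAlg E K) : Ad E k ⁅X, Y⁆ = ⁅Ad E k X, Ad E k Y⁆ := by
  have h := mpullback_mlieBracket (I := 𝓘(ℝ, E)) (I' := 𝓘(ℝ, E)) (n := minSmoothness ℝ 3)
    (f := fun x : K => k * x * k⁻¹) (x₀ := (1 : K))
    (mdifferentiableAt_mulInvariantVectorField (Ad E k X))
    (mdifferentiableAt_mulInvariantVectorField (Ad E k Y))
    ((contMDiff_conj (E := E) k).contMDiffAt.of_le ENat.LEInfty.out)
    (minSmoothness_monotone (by norm_cast))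
  rw [mpullback_conj_mulInvariantVectorField, mpullback_conj_mulInvariantVectorField] at h
  have h1 : k * 1 * k⁻¹ = 1 := by simp
  have h2 : ∀ z : K, z = 1 → (derivMap E (fun x : K => k * x * k⁻¹) 1).inverse
      (mlieBracket 𝓘(ℝ, E) (mulInvariantVectorField (Ad E k X))
        (mulInvariantVectorField (Ad E k Y)) z : E) = Ad E k⁻¹ ⁅Ad E k X, Ad E k Y⁆ := by
    rintro z rfl
    rw [inverse_derivMap_conj, h1]
    rfl
  have h3 : Ad E k⁻¹ ⁅Ad E k X, Ad E k Y⁆ = ⁅X, Y⁆ := (h2 _ h1).symm.trans h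
  rw [← h3, ← Ad_mul, mul_inv_cancel, Ad_one]

end AdjointRepresentation

/-! ### The derivative of `Ad` at the identity is `ad` -/

section DerivativeOfAd

open VectorField Filter Topology

lemma derivMap_mul_left_eq (g : K) :
    derivMap E (fun x : K => g * x) 1 = derivMap E (fun x : K => x * g) 1 ∘L adOp E g := by
  have h := derivMap_comp (E := E) (mdifferentiable_mul_right g) (mdifferentiable_conj g) 1
  change _ = _ ∘L derivMap E (fun x : K => g * x * g⁻¹) 1
  simpa using h

variable (E) in
/-- The derivative at `g` of the preferred chart at `1`. -/
def derivChart (g : K) : E →L[ℝ] E :=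
  mfderiv 𝓘(ℝ, E) 𝓘(ℝ, E) (extChartAt 𝓘(ℝ, E) (1 : K)) g

lemma derivChart_one : derivChart E (1 : K) = ContinuousLinearMap.id ℝ E :=
  mfderiv_extChartAt_self

instance instIsManifoldOfLieGroup : IsManifold 𝓘(ℝ, E) ∞ K :=
  LieGroup.toContMDiffMul.toIsManifold

variable (E K) in
/-- The multiplication of `K` in the preferred chart at `1`. -/
def chartMul (p : E × E) : E :=
  extChartAt 𝓘(ℝ, E) (1 : K)
    ((extChartAt 𝓘(ℝ, E) (1 : K)).symm p.1 * (extChartAt 𝓘(ℝ, E) (1 : K)).symm p.2)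

variable (E K) in
/-- The image of `1` in the preferred chart at `1`. -/
def chartOne : E := extChartAt 𝓘(ℝ, E) (1 : K) 1

lemma chartOne_symm : (extChartAt 𝓘(ℝ, E) (1 : K)).symm (chartOne E K) = 1 :=
  extChartAt_to_inv (I := 𝓘(ℝ, E)) (1 : K)

lemma contMDiffAt_chart_symm :
    ContMDiffAt 𝓘(ℝ, E) 𝓘(ℝ, E) ∞ (extChartAt 𝓘(ℝ, E) (1 : K)).symm (chartOne E K) :=
  (contMDiffOn_extChartAt_symm (1 : K)).contMDiffAt (extChartAt_target_mem_nhds (1 : K))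

lemma contDiffAt_chartMul :
    ContDiffAt ℝ ∞ (chartMul E K) (chartOne E K, chartOne E K) := by
  rw [← contMDiffAt_iff_contDiffAt]
  have h1 : ContMDiffAt 𝓘(ℝ, E × E) 𝓘(ℝ, E) ∞
      (fun p : E × E => (extChartAt 𝓘(ℝ, E) (1 : K)).symm p.1) (chartOne E K, chartOne E K) :=
    ContMDiffAt.comp (chartOne E K, chartOne E K) contMDiffAt_chart_symm
      contDiff_fst.contMDiff.contMDiffAt
  have h2 : ContMDiffAt 𝓘(ℝ, E × E) 𝓘(ℝ, E) ∞
      (fun p : E × E => (extChartAt 𝓘(ℝ, E) (1 : K)).symm p.2) (chartOne E K, chartOne E K) :=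
    ContMDiffAt.comp (chartOne E K, chartOne E K) contMDiffAt_chart_symm
      contDiff_snd.contMDiff.contMDiffAt
  refine ContMDiffAt.comp _ (contMDiffAt_extChartAt' ?_) (h1.mul h2)
  change (extChartAt 𝓘(ℝ, E) (1 : K)).symm (chartOne E K) *
    (extChartAt 𝓘(ℝ, E) (1 : K)).symm (chartOne E K) ∈ _
  rw [chartOne_symm, mul_one]
  exact mem_chart_source E 1

lemma hasFDerivAt_comp_chart_symm {F : K → E} (hF : MDifferentiableAt 𝓘(ℝ, E) 𝓘(ℝ, E) F 1) :
    HasFDerivAt (fun x => F ((extChartAt 𝓘(ℝ, E) (1 : K)).symm x))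
      (mfderiv 𝓘(ℝ, E) 𝓘(ℝ, E) F 1 : E →L[ℝ] E) (chartOne E K) := by
  have h := hF.hasMFDerivAt.2
  simp only [modelWithCornersSelf_coe, Set.range_id] at h
  exact hasFDerivWithinAt_univ.1 h

variable (E K) in
/-- The derivative of `chartMul` at `(x, 1)` in the second variable. -/
def chartLeft (x : E) : E →L[ℝ] E :=
  fderiv ℝ (chartMul E K) (x, chartOne E K) ∘L ContinuousLinearMap.inr ℝ E E

variable (E K) in
/-- The derivative of `chartMul` at `(1, x)` in the first variable. -/
def chartRight (x : E) : E →L[ℝ] E :=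
  fderiv ℝ (chartMul E K) (chartOne E K, x) ∘L ContinuousLinearMap.inl ℝ E E

lemma eventually_differentiableAt_chartMul :
    ∀ᶠ p in 𝓝 (chartOne E K, chartOne E K), DifferentiableAt ℝ (chartMul E K) p := by
  have h : ContDiffAt ℝ 1 (chartMul E K) (chartOne E K, chartOne E K) :=
    contDiffAt_chartMul.of_le (by simp)
  filter_upwards [h.eventually (by simp)] with p hp
  exact hp.differentiableAt (by simp)

lemma mdifferentiableAt_chart {g : K} (hg : g ∈ (chartAt E (1 : K)).source) :
    MDifferentiableAt 𝓘(ℝ, E) 𝓘(ℝ, E) (extChartAt 𝓘(ℝ, E) (1 : K)) g :=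
  mdifferentiableAt_extChartAt hg

lemma eventually_symm_mem_source :
    ∀ᶠ x in 𝓝 (chartOne E K), x ∈ (extChartAt 𝓘(ℝ, E) (1 : K)).target ∧
      (extChartAt 𝓘(ℝ, E) (1 : K)).symm x ∈ (chartAt E (1 : K)).source := by
  filter_upwards [extChartAt_target_mem_nhds (I := 𝓘(ℝ, E)) (1 : K)] with x hx
  refine ⟨hx, ?_⟩
  have := (extChartAt 𝓘(ℝ, E) (1 : K)).map_target hx
  rwa [extChartAt_source] at this

lemma mfderiv_chart_comp {f : K → K} (hf : MDifferentiable 𝓘(ℝ, E) 𝓘(ℝ, E) f)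
    (h1 : f 1 ∈ (chartAt E (1 : K)).source) :
    HasFDerivAt (fun x => extChartAt 𝓘(ℝ, E) (1 : K) (f ((extChartAt 𝓘(ℝ, E) (1 : K)).symm x)))
      (derivChart E (f 1) ∘L derivMap E f 1) (chartOne E K) := by
  have h := hasFDerivAt_comp_chart_symm ((mdifferentiableAt_chart h1).comp 1 (hf 1))
  rw [mfderiv_comp 1 (mdifferentiableAt_chart h1) (hf 1)] at h
  exact h

/-- Near `1`, `chartMul` with first argument `x` fixed is a left translation read in the chart; the
chain rule gives its derivative at `1`. -/
lemma eventually_chartLeft_eq :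
    ∀ᶠ x in 𝓝 (chartOne E K), chartLeft E K x =
      derivChart E ((extChartAt 𝓘(ℝ, E) (1 : K)).symm x) ∘L
        derivMap E (fun y : K => (extChartAt 𝓘(ℝ, E) (1 : K)).symm x * y) 1 := by
  have hc : Tendsto (fun x : E => (x, chartOne E K)) (𝓝 (chartOne E K))
      (𝓝 (chartOne E K, chartOne E K)) :=
    (Continuous.prodMk continuous_id continuous_const).tendsto' _ _ rfl
  filter_upwards [eventually_symm_mem_source (E := E) (K := K),
    hc.eventually eventually_differentiableAt_chartMul] with x hx hd
  have h := mfderiv_chart_comp (E := E)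
    (mdifferentiable_mul_left ((extChartAt 𝓘(ℝ, E) (1 : K)).symm x)) (by simpa using hx.2)
  rw [mul_one] at h
  exact (hd.hasFDerivAt.comp (chartOne E K)
    (hasFDerivAt_prodMk_right x (chartOne E K))).unique h

lemma eventually_chartRight_eq :
    ∀ᶠ x in 𝓝 (chartOne E K), chartRight E K x =
      derivChart E ((extChartAt 𝓘(ℝ, E) (1 : K)).symm x) ∘L
        derivMap E (fun y : K => y * (extChartAt 𝓘(ℝ, E) (1 : K)).symm x) 1 := by
  have hc : Tendsto (fun x : E => (chartOne E K, x)) (𝓝 (chartOne E K))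
      (𝓝 (chartOne E K, chartOne E K)) :=
    (Continuous.prodMk continuous_const continuous_id).tendsto' _ _ rfl
  filter_upwards [eventually_symm_mem_source (E := E) (K := K),
    hc.eventually eventually_differentiableAt_chartMul] with x hx hd
  have h := mfderiv_chart_comp (E := E)
    (mdifferentiable_mul_right ((extChartAt 𝓘(ℝ, E) (1 : K)).symm x)) (by simpa using hx.2)
  rw [one_mul] at h
  exact (HasFDerivAt.comp (g := chartMul E K) (f := fun y => (y, x)) (chartOne E K)
    hd.hasFDerivAt (hasFDerivAt_prodMk_left (chartOne E K) x)).unique h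

lemma chartLeft_one : chartLeft E K (chartOne E K) = ContinuousLinearMap.id ℝ E := by
  have h := (eventually_chartLeft_eq (E := E) (K := K)).self_of_nhds
  rw [chartOne_symm, derivChart_one] at h
  simpa [derivMap_id] using h

lemma chartRight_one : chartRight E K (chartOne E K) = ContinuousLinearMap.id ℝ E := by
  have h := (eventually_chartRight_eq (E := E) (K := K)).self_of_nhds
  rw [chartOne_symm, derivChart_one] at h
  simpa [derivMap_id] using h

variable (E K) in
/-- The mixed second derivative at `(1, 1)` of the multiplication in the chart. -/
def chartMixed : E →L[ℝ] E →L[ℝ] E :=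
  (ContinuousLinearMap.compL ℝ E (E × E) E).flip (ContinuousLinearMap.inr ℝ E E) ∘L
    fderiv ℝ (fderiv ℝ (chartMul E K)) (chartOne E K, chartOne E K) ∘L
      ContinuousLinearMap.inl ℝ E E

lemma hasFDerivAt_fderiv_chartMul :
    HasFDerivAt (fderiv ℝ (chartMul E K))
      (fderiv ℝ (fderiv ℝ (chartMul E K)) (chartOne E K, chartOne E K))
      (chartOne E K, chartOne E K) := by
  have h : ContDiffAt ℝ 1 (fderiv ℝ (chartMul E K)) (chartOne E K, chartOne E K) :=
    contDiffAt_chartMul.fderiv_right (m := 1) (by norm_cast)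
  exact (h.differentiableAt (by simp)).hasFDerivAt

lemma hasFDerivAt_chartLeft :
    HasFDerivAt (chartLeft E K) (chartMixed E K) (chartOne E K) := by
  have h := HasFDerivAt.comp (g := fderiv ℝ (chartMul E K)) (f := fun y => (y, chartOne E K))
    (chartOne E K) hasFDerivAt_fderiv_chartMul
    (hasFDerivAt_prodMk_left (chartOne E K) (chartOne E K))
  exact ((ContinuousLinearMap.compL ℝ E (E × E) E).flip
    (ContinuousLinearMap.inr ℝ E E)).hasFDerivAt.comp (chartOne E K) h

/-- The same mixed derivative as for `chartLeft`, with arguments exchanged, by symmetry of the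
second derivative. -/
lemma hasFDerivAt_chartRight :
    HasFDerivAt (chartRight E K) (chartMixed E K).flip (chartOne E K) := by
  have h := hasFDerivAt_fderiv_chartMul (E := E) (K := K).comp (chartOne E K)
    (hasFDerivAt_prodMk_right (chartOne E K) (chartOne E K))
  have h2 := ((ContinuousLinearMap.compL ℝ E (E × E) E).flip
    (ContinuousLinearMap.inl ℝ E E)).hasFDerivAt.comp (chartOne E K) h
  refine h2.congr_fderiv ?_
  ext X Y
  exact (contDiffAt_chartMul (E := E) (K := K)).isSymmSndFDerivAt
    (by rw [minSmoothness_of_isRCLikeNormedField]; exact ENat.LEInfty.out) (0, X) (Y, 0)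

/-- In the chart the left-invariant field of `X` is `x ↦ chartLeft x X`. The vector field bracket
`DW·V - DV·W` at `1` then involves only the mixed derivative. -/
lemma lie_eq_chartMixed (X Y : LieAlg E K) :
    (⁅X, Y⁆ : LieAlg E K) = chartMixed E K X Y - chartMixed E K Y X := by
  let P : E → E → E := fun X => mpullbackWithin 𝓘(ℝ, E) 𝓘(ℝ, E)
    (extChartAt 𝓘(ℝ, E) (1 : K)).symm (mulInvariantVectorField (I := 𝓘(ℝ, E)) (G := K) X)
    (Set.range 𝓘(ℝ, E))
  have hv : ∀ X : E, P X =ᶠ[𝓝 (chartOne E K)] fun x => chartLeft E K x X := by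
    intro X
    filter_upwards [eventually_symm_mem_source (E := E) (K := K),
      eventually_chartLeft_eq (E := E) (K := K)] with x hx hl
    rw [hl]
    have h := ContinuousLinearMap.inverse_eq
      (mfderivWithin_extChartAt_symm_comp_mfderiv_extChartAt (I := 𝓘(ℝ, E)) hx.1)
      (mfderiv_extChartAt_comp_mfderivWithin_extChartAt_symm (I := 𝓘(ℝ, E)) hx.1)
    change (mfderivWithin 𝓘(ℝ, E) 𝓘(ℝ, E) _ _ x).inverse _ = _
    rw [h]
    rfl
  have hd : ∀ X : E, HasFDerivAt (fun x => chartLeft E K x X) ((chartMixed E K).flip X)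
      (chartOne E K) := fun X => by
    have h := (hasFDerivAt_chartLeft (E := E) (K := K)).clm_apply (hasFDerivAt_const X _)
    simpa using h
  have h1 : (⁅X, Y⁆ : LieAlg E K) = lieBracket ℝ (fun x => chartLeft E K x X)
      (fun x => chartLeft E K x Y) (chartOne E K) := by
    have hu : (extChartAt 𝓘(ℝ, E) (1 : K)).symm ⁻¹' Set.univ ∩ Set.range 𝓘(ℝ, E) = Set.univ := by
      simp
    have h2 : (⁅X, Y⁆ : LieAlg E K) = (ContinuousLinearMap.id ℝ E).inverse
        (lieBracketWithin ℝ (P X) (P Y) Set.univ (chartOne E K)) := by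
      rw [GroupLieAlgebra.bracket_def, mlieBracket, mlieBracketWithin_apply,
        mfderiv_extChartAt_self, hu]
      rfl
    rw [h2, ContinuousLinearMap.inverse_id, lieBracketWithin_univ]
    exact Filter.EventuallyEq.lieBracket_vectorField_eq (𝕜 := ℝ) (E := E) (hv X) (hv Y)
  rw [h1, lieBracket, (hd X).fderiv, (hd Y).fderiv, chartLeft_one]
  rfl

/-- Left translation by `g` is conjugation by `g` followed by right translation, so `chartLeft =
chartRight ∘ Ad`. Differentiating at `1` with the product rule, the derivative of `Ad` is the
antisymmetrization of `chartMixed`. -/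
lemma hasFDerivAt_adOp_chart : ∃ A : E →L[ℝ] E →L[ℝ] E,
    HasFDerivAt (fun x => adOp E ((extChartAt 𝓘(ℝ, E) (1 : K)).symm x)) A (chartOne E K) ∧
      ∀ X Y : LieAlg E K, A X Y = (⁅X, Y⁆ : LieAlg E K) := by
  have hc : ContDiffAt ℝ ∞ (fun x => adOp E ((extChartAt 𝓘(ℝ, E) (1 : K)).symm x))
      (chartOne E K) := by
    rw [← contMDiffAt_iff_contDiffAt]
    exact contMDiff_adOp.contMDiffAt.comp (chartOne E K) contMDiffAt_chart_symm
  have hA := (hc.differentiableAt (by simp)).hasFDerivAt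
  refine ⟨_, hA, fun X Y => ?_⟩
  have hl : chartLeft E K =ᶠ[𝓝 (chartOne E K)] fun x =>
      chartRight E K x ∘L adOp E ((extChartAt 𝓘(ℝ, E) (1 : K)).symm x) := by
    filter_upwards [eventually_chartLeft_eq (E := E) (K := K),
      eventually_chartRight_eq (E := E) (K := K)] with x h1 h2
    rw [h1, h2, derivMap_mul_left_eq]
    rfl
  have h := ((hasFDerivAt_chartLeft.congr_of_eventuallyEq hl.symm).unique
    (hasFDerivAt_chartRight.clm_comp hA))
  have h2 := congrArg (fun f : E →L[ℝ] E →L[ℝ] E => f X Y) h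
  simp only [chartOne_symm, adOp_one, chartRight_one] at h2
  rw [lie_eq_chartMixed, eq_sub_iff_add_eq]
  exact h2.symm

/-- Each element of the Lie algebra is the velocity at `1` of a curve in `K`, along which the
derivative of `Ad` is the adjoint operator. -/
lemma exists_curve_adOp (X : LieAlg E K) : ∃ (c : ℝ → K) (A : E →L[ℝ] E), c 0 = 1 ∧
    HasDerivAt (fun t => adOp E (c t)) A 0 ∧
      ∀ Y : LieAlg E K, A Y = (⁅X, Y⁆ : LieAlg E K) := by
  obtain ⟨A, hA, hA'⟩ := hasFDerivAt_adOp_chart (E := E) (K := K)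
  obtain ⟨X', hX'⟩ : ∃ X' : E, X' = X := ⟨X, rfl⟩
  have hd : HasDerivAt (fun t : ℝ => chartOne E K + t • X') X' 0 := by
    simpa using ((hasDerivAt_id (0 : ℝ)).smul_const X').const_add (chartOne E K)
  refine ⟨fun t => (extChartAt 𝓘(ℝ, E) (1 : K)).symm (chartOne E K + t • X'), A X', ?_, ?_, ?_⟩
  · simp only [zero_smul, add_zero, chartOne_symm]
  · exact HasFDerivAt.comp_hasDerivAt_of_eq 0 hA hd (by simp)
  · subst hX'
    exact hA' X'

end DerivativeOfAd

/-! ### Exponentials of `ad X` inside the compact group `Ad K` -/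

section ExponentialLimit

open Filter Topology

/-- Telescoping. The hypothesis is `‖1‖ ≤ 1` rather than equality so that operators on the zero
space are included. -/
lemma norm_pow_sub_pow_le_mul {A : Type*} [NormedRing A] (h1 : ‖(1 : A)‖ ≤ 1) {x y : A} {M : ℝ}
    (hM : 1 ≤ M) (hx : ‖x‖ ≤ M) (hy : ‖y‖ ≤ M) (n : ℕ) :
    ‖x ^ n - y ^ n‖ ≤ n * M ^ n * ‖x - y‖ := by
  have hM0 : 0 ≤ M := zero_le_one.trans hM
  have hpow : ∀ n : ℕ, ‖x ^ n‖ ≤ M ^ n := fun n => by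
    induction n with
    | zero => simpa using h1
    | succ n ih =>
      rw [pow_succ, pow_succ]
      exact (norm_mul_le _ _).trans (mul_le_mul ih hx (norm_nonneg _) (pow_nonneg hM0 n))
  induction n with
  | zero => simp
  | succ n ih =>
    have h : x ^ (n + 1) - y ^ (n + 1) = x ^ n * (x - y) + (x ^ n - y ^ n) * y := by
      rw [pow_succ, pow_succ]; noncomm_ring
    have a1 : ‖x ^ n * (x - y)‖ ≤ M ^ n * ‖x - y‖ :=
      (norm_mul_le _ _).trans (mul_le_mul_of_nonneg_right (hpow n) (norm_nonneg _))
    have a2 : ‖(x ^ n - y ^ n) * y‖ ≤ n * M ^ n * ‖x - y‖ * M :=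
      (norm_mul_le _ _).trans (mul_le_mul ih hy (norm_nonneg _) (by positivity))
    have a3 : M ^ n * ‖x - y‖ ≤ M ^ n * ‖x - y‖ * M :=
      le_mul_of_one_le_right (by positivity) hM
    rw [h]
    refine (norm_add_le _ _).trans ?_
    push_cast
    rw [pow_succ]
    nlinarith

/-- The elements `c (1/n)` and `exp (a/n)` differ by `o(1/n)`, and taking `n`-th powers multiplies
the error by at most a constant times `n`. -/
lemma tendsto_pow_exp_of_hasDerivAt {A : Type*} [NormedRing A] [NormedAlgebra ℝ A]
    [CompleteSpace A] (h1 : ‖(1 : A)‖ ≤ 1) {c : ℝ → A} {a : A} (hc : HasDerivAt c a 0)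
    (hc0 : c 0 = 1) :
    Tendsto (fun n : ℕ => c ((n : ℝ)⁻¹) ^ n) atTop (𝓝 (NormedSpace.exp a)) := by
  have hinv : Tendsto (fun n : ℕ => ((n : ℝ)⁻¹)) atTop (𝓝 0) :=
    tendsto_inv_atTop_zero.comp tendsto_natCast_atTop_atTop
  have he : HasDerivAt (fun s : ℝ => NormedSpace.exp (s • a)) a 0 := by
    simpa using hasDerivAt_exp_smul_const (𝕂 := ℝ) a 0
  have hf : HasDerivAt (fun s : ℝ => c s - NormedSpace.exp (s • a)) 0 0 := by
    exact (hc.sub he).congr_deriv (sub_self a)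
  have hlo := (hasDerivAt_iff_isLittleO.1 hf).comp_tendsto hinv
  simp only [Function.comp_def, hc0, zero_smul, NormedSpace.exp_zero, sub_self, sub_zero,
    smul_zero] at hlo
  obtain ⟨C₁, hC₁⟩ := (hc.differentiableAt.isBigO_sub.comp_tendsto hinv).bound
  obtain ⟨C₂, hC₂⟩ := (he.differentiableAt.isBigO_sub.comp_tendsto hinv).bound
  simp only [Function.comp_def, hc0, zero_smul, NormedSpace.exp_zero, sub_zero] at hC₁ hC₂
  set C := max (max C₁ C₂) 0
  have hC0 : 0 ≤ C := le_max_right _ _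
  have key : ∀ᶠ n : ℕ in atTop, ‖c ((n : ℝ)⁻¹) ^ n - NormedSpace.exp a‖ ≤
      Real.exp C * (‖c ((n : ℝ)⁻¹) - NormedSpace.exp ((n : ℝ)⁻¹ • a)‖ / (n : ℝ)⁻¹) := by
    filter_upwards [hC₁, hC₂, eventually_gt_atTop 0] with n hn1 hn2 hn
    have hn' : (0 : ℝ) < n := by exact_mod_cast hn
    have hnorm : ‖((n : ℝ)⁻¹)‖ = (n : ℝ)⁻¹ := Real.norm_of_nonneg (by positivity)
    have hbd : ∀ (x : A) (D : ℝ), D ≤ C → ‖x - 1‖ ≤ D * ‖((n : ℝ)⁻¹)‖ →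
        ‖x‖ ≤ Real.exp (C * (n : ℝ)⁻¹) := by
      intro x D hD hx
      rw [hnorm] at hx
      have h2 : ‖x‖ ≤ ‖x - 1‖ + ‖(1 : A)‖ := by simpa using norm_add_le (x - 1) 1
      have h3 : D * (n : ℝ)⁻¹ ≤ C * (n : ℝ)⁻¹ := mul_le_mul_of_nonneg_right hD (by positivity)
      have h4 := Real.add_one_le_exp (C * (n : ℝ)⁻¹)
      linarith
    -- With the bound `M = exp (C/n)` on both elements, `M ^ n = exp C` does not depend on `n`.
    have h := norm_pow_sub_pow_le_mul h1 (Real.one_le_exp (by positivity))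
      (hbd _ C₁ ((le_max_left _ _).trans (le_max_left _ _)) hn1)
      (hbd _ C₂ ((le_max_right _ _).trans (le_max_left _ _)) hn2) n
    let : NormedAlgebra ℚ A := NormedAlgebra.restrictScalars ℚ ℝ A
    rw [← NormedSpace.exp_nsmul, ← Nat.cast_smul_eq_nsmul ℝ, smul_smul,
      mul_inv_cancel₀ hn'.ne', one_smul, ← Real.exp_nat_mul,
      show (n : ℝ) * (C * (n : ℝ)⁻¹) = C by field_simp] at h
    rw [div_inv_eq_mul]
    linarith
  refine tendsto_iff_norm_sub_tendsto_zero.2 (squeeze_zero' (by simp) key ?_)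
  have h0 : Tendsto (fun n : ℕ => ‖c ((n : ℝ)⁻¹) - NormedSpace.exp ((n : ℝ)⁻¹ • a)‖ / (n : ℝ)⁻¹)
      atTop (𝓝 0) := by
    refine hlo.norm_left.tendsto_div_nhds_zero
  simpa using h0.const_mul (Real.exp C)

variable [CompactSpace K]

/-- The image of `Ad` is compact, hence closed, and contains the powers `Ad (c (1/n)) ^ n`; no
exponential map of `K` is needed. -/
lemma exists_adOp_eq_exp {c : ℝ → K} {A : E →L[ℝ] E} (hc0 : c 0 = 1)
    (hc : HasDerivAt (fun t => adOp E (c t)) A 0) :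
    ∃ k : K, adOp E k = NormedSpace.exp A := by
  have hcl : IsClosed (Set.range (adOp E : K → E →L[ℝ] E)) :=
    (isCompact_range continuous_adOp).isClosed
  refine hcl.mem_of_tendsto (tendsto_pow_exp_of_hasDerivAt ContinuousLinearMap.norm_id_le hc
    (by simp only [hc0, adOp_one])) (Eventually.of_forall fun n => ?_)
  exact ⟨c _ ^ n, adOp_pow _ n⟩

/-- If `ad X` acts on the plane spanned by `C` and `B` as a rotation generator, then a suitable
element of `K` negates `C` and fixes the centralizer of `X`. -/
lemma exists_Ad_neg {X B C : LieAlg E K} {c : ℝ} (hc : 0 < c) (hC : ⁅X, C⁆ = -(c • B))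
    (hB : ⁅X, B⁆ = C) : ∃ k : K, Ad E k C = -C ∧ ∀ H : LieAlg E K, ⁅X, H⁆ = 0 → Ad E k H = H := by
  -- The rotation has angular speed `√c`, so this is the time of a half turn.
  set t : ℝ := Real.pi / Real.sqrt c
  have hs : 0 < Real.sqrt c := Real.sqrt_pos.2 hc
  have hss : Real.sqrt c * Real.sqrt c = c := Real.mul_self_sqrt hc.le
  obtain ⟨γ, A, hγ0, hγ, hA⟩ := exists_curve_adOp X
  have hγt : HasDerivAt (fun s : ℝ => adOp E (γ (t * s))) (t • A) 0 := by
    have h1 : HasDerivAt (fun s : ℝ => t * s) t 0 := by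
      simpa using (hasDerivAt_id (0 : ℝ)).const_mul t
    exact HasDerivAt.scomp_of_eq (h := fun s : ℝ => t * s) (h' := t) 0 hγ h1 (by simp)
  obtain ⟨k, hk⟩ := exists_adOp_eq_exp (c := fun s => γ (t * s)) (by simp [hγ0]) hγt
  -- Uniqueness for `f' = A f`: the curve `exp (-sA) (f s)` has zero derivative. It is applied to an
  -- explicit rotating curve and to constants.
  have hconst : ∀ f : ℝ → E, (∀ s, HasDerivAt f (A (f s)) s) →
      ∀ s : ℝ, NormedSpace.exp (s • A) (f 0) = f s := by
    intro f hf s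
    have hd : ∀ s : ℝ, HasDerivAt (fun s : ℝ => NormedSpace.exp ((-s) • A) (f s)) 0 s := by
      intro s
      have h1 : HasDerivAt (fun s : ℝ => NormedSpace.exp ((-s) • A))
          (-(NormedSpace.exp ((-s) • A) * A)) s := by
        have := HasDerivAt.scomp (h := fun s : ℝ => -s) s
          (hasDerivAt_exp_smul_const (𝕂 := ℝ) A (-s)) (hasDerivAt_neg s)
        simpa [Function.comp_def] using this
      simpa using h1.clm_apply (hf s)
    have hcst := is_const_of_deriv_eq_zero (fun s => (hd s).differentiableAt)
      (fun s => (hd s).deriv) s 0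
    let : NormedAlgebra ℚ (E →L[ℝ] E) := NormedAlgebra.restrictScalars ℚ ℝ _
    have hm : NormedSpace.exp (s • A) * NormedSpace.exp ((-s) • A) = 1 := by
      rw [← NormedSpace.exp_add_of_commute ((Commute.refl A).smul_left s |>.smul_right (-s)),
        ← add_smul, add_neg_cancel, zero_smul, NormedSpace.exp_zero]
    simp only [neg_zero, zero_smul, NormedSpace.exp_zero, one_apply_eq_self] at hcst
    rw [← hcst, ← mul_apply_eq_comp, hm, one_apply_eq_self]
  obtain ⟨B', hB'⟩ : ∃ B' : E, B' = B := ⟨B, rfl⟩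
  obtain ⟨C', hC'⟩ : ∃ C' : E, C' = C := ⟨C, rfl⟩
  have hAB : A B' = C' := by subst hB' hC'; exact (hA _).trans hB
  have hAC : A C' = -((Real.sqrt c * Real.sqrt c) • B') := by
    rw [hss]; subst hB' hC'; exact (hA _).trans hC
  refine ⟨k, ?_, fun H hH => ?_⟩
  · have h := hconst (fun s => Real.cos (Real.sqrt c * s) • C' -
      (Real.sqrt c * Real.sin (Real.sqrt c * s)) • B') (fun s => by
        have h0 : HasDerivAt (fun s : ℝ => Real.sqrt c * s) (Real.sqrt c) s := by
          simpa using (hasDerivAt_id s).const_mul (Real.sqrt c)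
        have h1 := (h0.cos.smul_const C').sub ((h0.sin.const_mul (Real.sqrt c)).smul_const B')
        refine h1.congr_deriv ?_
        rw [map_sub, map_smul, map_smul, hAB, hAC]
        module) t
    have h2 : Real.sqrt c * t = Real.pi := by simp only [t]; field_simp
    simp only [mul_zero, Real.cos_zero, one_smul, Real.sin_zero, zero_smul, sub_zero, h2,
      Real.cos_pi, Real.sin_pi, neg_smul] at h
    rw [← hk] at h
    subst hC'
    exact h
  · obtain ⟨H', hH'⟩ : ∃ H' : E, H' = H := ⟨H, rfl⟩
    have hAH : A H' = 0 := by subst hH'; exact (hA _).trans hH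
    have h := hconst (fun _ => H') (fun s => by rw [hAH]; exact hasDerivAt_const s H') t
    rw [← hk] at h
    subst hH'
    exact h

end ExponentialLimit

/-! ### Negative definiteness of the Killing form -/

section KillingForm

open MeasureTheory

section Skew

variable {L : Type*} [LieRing L] [LieAlgebra ℝ L] [FiniteDimensional ℝ L]

/-- In a `P`-orthogonal basis the diagonal entries of `T²` are `-P(Tvᵢ, Tvᵢ) / P(vᵢ, vᵢ)`. -/
lemma trace_sq_neg_of_skew (P : LinearMap.BilinForm ℝ L) (hs : P.IsSymm)
    (hp : ∀ x, x ≠ 0 → 0 < P x x) (T : L →ₗ[ℝ] L) (hT : ∀ x y, P (T x) y = -P x (T y))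
    (hT0 : T ≠ 0) : LinearMap.trace ℝ L (T ∘ₗ T) < 0 := by
  let : Invertible (2 : ℝ) := invertibleOfNonzero two_ne_zero
  obtain ⟨v, hv⟩ := LinearMap.BilinForm.exists_orthogonal_basis
    (LinearMap.BilinForm.isSymm_iff.1 hs)
  have hcoord : ∀ x i, P (v i) (v i) * v.repr x i = P x (v i) := by
    intro x i
    conv_rhs => rw [← v.sum_repr x]
    rw [map_sum, LinearMap.sum_apply, Finset.sum_eq_single i]
    · rw [map_smul, LinearMap.smul_apply, smul_eq_mul, mul_comm]
    · intro j _ hj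
      rw [map_smul, LinearMap.smul_apply]
      have : P (v j) (v i) = 0 := hv hj
      rw [this, smul_zero]
    · simp
  have hpv : ∀ i, 0 < P (v i) (v i) := fun i => hp _ (v.ne_zero i)
  have hdiag : ∀ i, v.repr (T (T (v i))) i ≤ 0 ∧ (T (v i) ≠ 0 → v.repr (T (T (v i))) i < 0) := by
    intro i
    have h := hcoord (T (T (v i))) i
    rw [hT] at h
    constructor
    · by_cases h0 : T (v i) = 0
      · simp [h0]
      · by_contra hc
        have := mul_pos (hpv i) (not_le.1 hc)
        have := hp _ h0
        linarith
    · intro h0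
      by_contra hc
      have := mul_nonneg (hpv i).le (not_lt.1 hc)
      have := hp _ h0
      linarith
  rw [LinearMap.trace_eq_matrix_trace ℝ v, Matrix.trace]
  simp only [Matrix.diag, LinearMap.toMatrix_apply, LinearMap.comp_apply]
  obtain ⟨i, hi⟩ : ∃ i, T (v i) ≠ 0 := by
    by_contra hc
    exact hT0 (v.ext fun i => by simpa using (not_exists.1 hc i))
  exact Finset.sum_neg' (fun i _ => (hdiag i).1) ⟨i, Finset.mem_univ i, (hdiag i).2 hi⟩

/-- Here `ad x` is skew, and it is nonzero because a semisimple Lie algebra has trivial center. -/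
lemma killingForm_self_neg_of_skew [LieAlgebra.IsSemisimple ℝ L] (P : LinearMap.BilinForm ℝ L)
    (hs : P.IsSymm) (hp : ∀ x, x ≠ 0 → 0 < P x x) (hT : ∀ x y z : L, P ⁅x, y⁆ z = -P y ⁅x, z⁆)
    {x : L} (hx : x ≠ 0) : killingForm ℝ L x x < 0 := by
  rw [killingForm_apply_apply]
  refine trace_sq_neg_of_skew P hs hp _ (fun y z => hT x y z) fun h => hx ?_
  have h1 : x ∈ LieAlgebra.center ℝ L := by
    intro y
    rw [← lie_skew, neg_eq_zero]
    exact LinearMap.congr_fun h y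
  simpa using h1

end Skew

variable [T2Space K] [CompactSpace K]

variable (E K) in
-- Average a Euclidean form over Haar measure. The integrand uses `k⁻¹`, so that invariance under
-- `Ad l` becomes left invariance of the measure.
lemma exists_Ad_invariant_form : ∃ P : LinearMap.BilinForm ℝ E, P.IsSymm ∧
    (∀ x, x ≠ 0 → 0 < P x x) ∧ ∀ (k : K) x y, P (adOp E k x) (adOp E k y) = P x y := by
  let : MeasurableSpace K := borel K
  have : BorelSpace K := ⟨rfl⟩
  have : IsTopologicalGroup K := topologicalGroup_of_lieGroup 𝓘(ℝ, E) ∞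
  let m : Measure K := Measure.haar
  let b := Module.finBasis ℝ E
  have hb : ∀ i, Continuous (b.coord i) := fun i => LinearMap.continuous_of_finiteDimensional _
  let f : E → E → K → ℝ := fun x y k =>
    ∑ i, b.coord i (adOp E k⁻¹ x) * b.coord i (adOp E k⁻¹ y)
  have hf : ∀ x y, Continuous (f x y) := fun x y => by
    have h : ∀ x, Continuous fun k : K => adOp E k⁻¹ x := fun x =>
      (continuous_adOp.comp continuous_inv).clm_apply continuous_const
    exact continuous_finsetSum _ fun i _ => ((hb i).comp (h x)).mul ((hb i).comp (h y))
  have hint : ∀ x y, Integrable (f x y) m := fun x y =>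
    (hf x y).integrable_of_hasCompactSupport (HasCompactSupport.of_compactSpace _)
  have hcomm : ∀ x y, f x y = f y x := fun x y => by
    funext k; exact Finset.sum_congr rfl fun i _ => mul_comm _ _
  have hadd : ∀ x x' y, f (x + x') y = fun k => f x y k + f x' y k := fun x x' y => by
    funext k
    simp only [f, map_add, add_mul, Finset.sum_add_distrib]
  have hsmul : ∀ (c : ℝ) x y, f (c • x) y = fun k => c * f x y k := fun c x y => by
    funext k
    simp only [f, map_smul, smul_eq_mul, Finset.mul_sum, mul_assoc]
  let P : LinearMap.BilinForm ℝ E := LinearMap.mk₂ ℝ (fun x y => ∫ k, f x y k ∂m)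
    (fun x x' y => by rw [hadd]; exact integral_add (hint _ _) (hint _ _))
    (fun c x y => by rw [hsmul]; exact integral_const_mul _ _)
    (fun x y y' => by
      rw [hcomm, hadd, hcomm x, hcomm x]; exact integral_add (hint _ _) (hint _ _))
    (fun c x y => by rw [hcomm, hsmul, hcomm x]; exact integral_const_mul _ _)
  refine ⟨P, ⟨fun x y => ?_⟩, fun x hx => ?_, fun l x y => ?_⟩
  · exact congrArg (fun g => ∫ k, g k ∂m) (hcomm x y)
  · refine (hf x x).integral_pos_of_hasCompactSupport_nonneg_nonzero
      (HasCompactSupport.of_compactSpace _)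
      (fun k => Finset.sum_nonneg fun i _ => mul_self_nonneg _) (x := 1) fun h0 => hx ?_
    have h1 := (Finset.sum_eq_zero_iff_of_nonneg fun i _ => mul_self_nonneg _).1 h0
    refine b.ext_elem fun i => ?_
    have h2 := mul_self_eq_zero.1 (h1 i (Finset.mem_univ i))
    simpa [adOp_one] using h2
  · have h : ∀ k, f (adOp E l x) (adOp E l y) k = f x y (l⁻¹ * k) := fun k => by
      simp only [f, mul_inv_rev, inv_inv, adOp_mul, mul_apply_eq_comp]
    change ∫ k, f (adOp E l x) (adOp E l y) k ∂m = ∫ k, f x y k ∂m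
    simp_rw [h]
    exact integral_mul_left_eq_self (f x y) l⁻¹

/-- Differentiating the invariance of the averaged form along a curve with velocity `X` makes `ad X`
skew. -/
lemma killingForm_self_neg [LieAlgebra.IsSemisimple ℝ (LieAlg E K)] {X : LieAlg E K}
    (hX : X ≠ 0) : killingForm ℝ (LieAlg E K) X X < 0 := by
  obtain ⟨P, hs, hp, hinv⟩ := exists_Ad_invariant_form E K
  have : FiniteDimensional ℝ (LieAlg E K) := inferInstanceAs (FiniteDimensional ℝ E)
  refine killingForm_self_neg_of_skew (L := LieAlg E K) P hs hp (fun X Y Z => ?_) hX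
  obtain ⟨c, A, hc0, hc, hA⟩ := exists_curve_adOp X
  obtain ⟨Y', hY'⟩ : ∃ Y' : E, Y' = Y := ⟨Y, rfl⟩
  obtain ⟨Z', hZ'⟩ : ∃ Z' : E, Z' = Z := ⟨Z, rfl⟩
  have hcl : ∀ Y' : E, HasDerivAt (fun t => adOp E (c t) Y') (A Y') 0 := fun Y' => by
    simpa using hc.clm_apply (hasDerivAt_const 0 Y')
  have h : HasDerivAt (fun t => P (adOp E (c t) Y') (adOp E (c t) Z'))
      (P Y' (A Z') + P (A Y') Z') 0 := by
    have := ContinuousLinearMap.hasDerivAt_of_bilinear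
      (B := LinearMap.toContinuousBilinearMap (E := E) (F := E) (G := ℝ) P)
      (fun _ => hcl Y') (fun _ => hcl Z')
    simpa [hc0, adOp_one] using this
  simp only [hinv] at h
  have h0 := h.unique (hasDerivAt_const 0 (P Y' Z'))
  have h1 : P (A Y') Z' = -P Y' (A Z') := by linarith
  subst hY' hZ'
  have e1 : A Y' = (⁅X, (show LieAlg E K from Y')⁆ : LieAlg E K) := hA _
  have e2 : A Z' = (⁅X, (show LieAlg E K from Z')⁆ : LieAlg E K) := hA _
  rw [e1, e2] at h1
  exact h1

end KillingForm

/-! ### Roots, duality between `𝔱` and `𝔱*`, and root reflections -/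

section Roots

instance instFiniteDimensionalLieAlg : FiniteDimensional ℝ (LieAlg E K) :=
  inferInstanceAs (FiniteDimensional ℝ E)

section Complexification

variable {L : Type*} [AddCommGroup L] [Module ℝ L]

lemma exists_eq_one_tmul_add_I_tmul (Z : ℂ ⊗[ℝ] L) :
    ∃ A B : L, Z = (1 : ℂ) ⊗ₜ[ℝ] A + Complex.I ⊗ₜ[ℝ] B := by
  induction Z with
  | zero => exact ⟨0, 0, by simp⟩
  | tmul z X =>
    refine ⟨z.re • X, z.im • X, ?_⟩
    rw [← TensorProduct.smul_tmul, ← TensorProduct.smul_tmul, ← TensorProduct.add_tmul]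
    congr 1
    conv_lhs => rw [← Complex.re_add_im z]
    simp
  | add Z Z' h h' =>
    obtain ⟨A, B, rfl⟩ := h
    obtain ⟨A', B', rfl⟩ := h'
    refine ⟨A + A', B + B', ?_⟩
    rw [TensorProduct.tmul_add, TensorProduct.tmul_add]
    abel

lemma one_tmul_add_I_tmul_inj {A B A' B' : L} :
    (1 : ℂ) ⊗ₜ[ℝ] A + Complex.I ⊗ₜ[ℝ] B = (1 : ℂ) ⊗ₜ[ℝ] A' + Complex.I ⊗ₜ[ℝ] B' ↔
      A = A' ∧ B = B' := by
  refine ⟨fun h => ?_, fun h => by rw [h.1, h.2]⟩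
  have h' := fun i => congrArg
    (fun Z => TensorProduct.equivFinsuppOfBasisLeft (N := L) Complex.basisOneI Z i) h
  refine ⟨by simpa using h' 0, by simpa using h' 1⟩

lemma one_tmul_lie {L : Type*} [LieRing L] [LieAlgebra ℝ L] (H A B : L) :
    ⁅(1 : ℂ) ⊗ₜ[ℝ] H, (1 : ℂ) ⊗ₜ[ℝ] A + Complex.I ⊗ₜ[ℝ] B⁆ =
      (1 : ℂ) ⊗ₜ[ℝ] ⁅H, A⁆ + Complex.I ⊗ₜ[ℝ] ⁅H, B⁆ := by
  refine (lie_add ((1 : ℂ) ⊗ₜ[ℝ] H) ((1 : ℂ) ⊗ₜ[ℝ] A) (Complex.I ⊗ₜ[ℝ] B)).trans ?_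
  rw [LieAlgebra.ExtendScalars.bracket_tmul, LieAlgebra.ExtendScalars.bracket_tmul,
    one_mul, one_mul]

end Complexification

lemma Ad_add (k : K) (X Y : LieAlg E K) : Ad E k (X + Y) = Ad E k X + Ad E k Y :=
  map_add (adOp E k) (X : E) Y

lemma Ad_smul (k : K) (c : ℝ) (X : LieAlg E K) : Ad E k (c • X) = c • Ad E k X :=
  map_smul (adOp E k) c (X : E)

lemma Ad_inv_Ad (k : K) (X : LieAlg E K) : Ad E k⁻¹ (Ad E k X) = X := by
  rw [← Ad_mul, inv_mul_cancel, Ad_one]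

lemma Ad_Ad_inv (k : K) (X : LieAlg E K) : Ad E k (Ad E k⁻¹ X) = X := by
  rw [← Ad_mul, mul_inv_cancel, Ad_one]

variable (E) in
/-- `Ad k` as an automorphism of the Lie algebra. -/
def adEquiv (k : K) : LieAlg E K ≃ₗ⁅ℝ⁆ LieAlg E K where
  toFun := Ad E k
  invFun := Ad E k⁻¹
  map_add' := Ad_add k
  map_smul' := Ad_smul k
  map_lie' := Ad_lie k _ _
  left_inv := Ad_inv_Ad k
  right_inv := Ad_Ad_inv k

lemma killingForm_Ad (k : K) (X Y : LieAlg E K) :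
    killingForm ℝ (LieAlg E K) (Ad E k X) (Ad E k Y) = killingForm ℝ (LieAlg E K) X Y :=
  LieAlgebra.killingForm_of_equiv_apply (adEquiv E k) X Y

variable {𝔱 : LieSubalgebra ℝ (LieAlg E K)}

lemma coact_apply (w : 𝔱 ≃ₗ[ℝ] 𝔱) (ν : TDual 𝔱) (H : 𝔱) : coact w ν H = ν (w.symm H) := rfl

lemma coact_mul (w w' : 𝔱 ≃ₗ[ℝ] 𝔱) (ν : TDual 𝔱) : coact (w * w') ν = coact w (coact w' ν) := rfl

lemma coact_one (ν : TDual 𝔱) : coact (1 : 𝔱 ≃ₗ[ℝ] 𝔱) ν = ν := rfl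

lemma coact_inv_coact (w : 𝔱 ≃ₗ[ℝ] 𝔱) (ν : TDual 𝔱) : coact w⁻¹ (coact w ν) = ν := by
  rw [← coact_mul, inv_mul_cancel, coact_one]

lemma coact_coact_inv (w : 𝔱 ≃ₗ[ℝ] 𝔱) (ν : TDual 𝔱) : coact w (coact w⁻¹ ν) = ν := by
  rw [← coact_mul, mul_inv_cancel, coact_one]

lemma weylGroup_symm_apply {w : 𝔱 ≃ₗ[ℝ] 𝔱} {k : K}
    (hk : ∀ H : 𝔱, ((w H : 𝔱) : LieAlg E K) = Ad E k H) (H : 𝔱) :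
    ((w.symm H : 𝔱) : LieAlg E K) = Ad E k⁻¹ H := by
  have h := hk (w.symm H)
  rw [w.apply_symm_apply] at h
  rw [h, Ad_inv_Ad]

/-- Split the root vector as `Z = A + iB`; this brings the root condition back to the real Lie
algebra, where `Ad K` acts. -/
lemma isRoot_iff {α : TDual 𝔱} : IsRoot α ↔ α ≠ 0 ∧ ∃ A B : LieAlg E K, (A ≠ 0 ∨ B ≠ 0) ∧
    ∀ H : 𝔱, ⁅(H : LieAlg E K), A⁆ = -(α H • B) ∧ ⁅(H : LieAlg E K), B⁆ = α H • A := by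
  have key : ∀ (A B : LieAlg E K) (H : 𝔱),
      ⁅(1 : ℂ) ⊗ₜ[ℝ] (H : LieAlg E K), (1 : ℂ) ⊗ₜ[ℝ] A + Complex.I ⊗ₜ[ℝ] B⁆ =
        (Complex.I * (α H : ℂ)) • ((1 : ℂ) ⊗ₜ[ℝ] A + Complex.I ⊗ₜ[ℝ] B) ↔
      ⁅(H : LieAlg E K), A⁆ = -(α H • B) ∧ ⁅(H : LieAlg E K), B⁆ = α H • A := by
    intro A B H
    have h1 : (Complex.I * (α H : ℂ)) • ((1 : ℂ) ⊗ₜ[ℝ] A + Complex.I ⊗ₜ[ℝ] B) =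
        (1 : ℂ) ⊗ₜ[ℝ] (-(α H • B)) + Complex.I ⊗ₜ[ℝ] (α H • A) := by
      rw [smul_add, TensorProduct.smul_tmul', TensorProduct.smul_tmul', ← neg_smul,
        ← TensorProduct.smul_tmul, ← TensorProduct.smul_tmul, add_comm]
      congr 2
      · simp only [smul_eq_mul, Complex.real_smul, Complex.ofReal_neg, mul_one]
        linear_combination (α H : ℂ) * Complex.I_mul_I
      · simp [mul_comm]
    have h2 : ⁅(1 : ℂ) ⊗ₜ[ℝ] (H : LieAlg E K), (1 : ℂ) ⊗ₜ[ℝ] A + Complex.I ⊗ₜ[ℝ] B⁆ =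
        (1 : ℂ) ⊗ₜ[ℝ] ⁅(H : LieAlg E K), A⁆ + Complex.I ⊗ₜ[ℝ] ⁅(H : LieAlg E K), B⁆ :=
      one_tmul_lie _ A B
    rw [h1, h2, one_tmul_add_I_tmul_inj]
  have hzero : ∀ A B : LieAlg E K, (1 : ℂ) ⊗ₜ[ℝ] A + Complex.I ⊗ₜ[ℝ] B = 0 ↔ A = 0 ∧ B = 0 := by
    intro A B
    rw [← one_tmul_add_I_tmul_inj]
    simp
  refine and_congr_right fun _ => ⟨?_, ?_⟩
  · rintro ⟨Z, hZ, h⟩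
    obtain ⟨A, B, rfl⟩ := exists_eq_one_tmul_add_I_tmul Z
    rw [Ne, hzero, not_and_or] at hZ
    exact ⟨A, B, hZ, fun H => (key A B H).1 (h H)⟩
  · rintro ⟨A, B, hAB, h⟩
    exact ⟨_, by rw [Ne, hzero, not_and_or]; exact hAB, fun H => (key A B H).2 (h H)⟩

lemma coact_ne_zero (w : 𝔱 ≃ₗ[ℝ] 𝔱) {α : TDual 𝔱} (h : α ≠ 0) : coact w α ≠ 0 := fun h0 =>
  h (by rw [← coact_inv_coact w α, h0]; rfl)

lemma IsRoot.coact {w : 𝔱 ≃ₗ[ℝ] 𝔱} (hw : w ∈ weylGroup 𝔱) {α : TDual 𝔱} (hα : IsRoot α) :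
    IsRoot (coact w α) := by
  obtain ⟨k, hk⟩ := hw
  obtain ⟨h0, A, B, hAB, h⟩ := isRoot_iff.1 hα
  refine isRoot_iff.2 ⟨coact_ne_zero w h0, Ad E k A, Ad E k B, ?_, fun H => ?_⟩
  · refine hAB.imp (fun hA h' => hA ?_) (fun hB h' => hB ?_)
    · exact (adEquiv E k).injective (h'.trans (map_zero (adEquiv E k)).symm)
    · exact (adEquiv E k).injective (h'.trans (map_zero (adEquiv E k)).symm)
  · have hH : (H : LieAlg E K) = Ad E k (w.symm H : 𝔱) := by rw [← hk, w.apply_symm_apply]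
    rw [coact_apply, hH, ← Ad_lie, ← Ad_lie, (h _).1, (h _).2, ← neg_smul, Ad_smul, Ad_smul,
      neg_smul]
    exact ⟨rfl, rfl⟩

variable [T2Space K] [CompactSpace K] [LieAlgebra.IsSemisimple ℝ (LieAlg E K)]

variable (𝔱) in
/-- The isomorphism `𝔱 ≅ 𝔱*` given by the negative of the Killing form. -/
def flat : 𝔱 →ₗ[ℝ] TDual 𝔱 :=
  -((killingForm ℝ (LieAlg E K)).compl₁₂ (𝔱 : Submodule ℝ (LieAlg E K)).subtype
    (𝔱 : Submodule ℝ (LieAlg E K)).subtype)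

lemma flat_apply (X H : 𝔱) : flat 𝔱 X H = -killingForm ℝ (LieAlg E K) X H := rfl

lemma flat_injective : Function.Injective (flat 𝔱) := by
  rw [← LinearMap.ker_eq_bot, LinearMap.ker_eq_bot']
  intro X hX
  by_contra h
  have h1 := LinearMap.congr_fun hX X
  have h2 := killingForm_self_neg (X := (X : LieAlg E K)) (fun h' => h (Subtype.ext h'))
  rw [flat_apply, LinearMap.zero_apply] at h1
  linarith

/-- `sharp` is only a chosen inverse; it is a true one since `flat` is injective by definiteness,
hence surjective by dimension. -/
lemma flat_sharp (ν : TDual 𝔱) : flat 𝔱 (sharp ν) = ν :=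
  Function.invFun_eq (f := flat 𝔱) ((LinearMap.injective_iff_surjective_of_finrank_eq_finrank
    (Subspace.dual_finrank_eq).symm).1 flat_injective ν)

lemma sharp_flat (X : 𝔱) : sharp (flat 𝔱 X) = X := flat_injective (flat_sharp _)

lemma killingForm_sharp (ν : TDual 𝔱) (H : 𝔱) :
    killingForm ℝ (LieAlg E K) (sharp ν : 𝔱) H = -ν H := by
  conv_rhs => rw [← flat_sharp ν, flat_apply, neg_neg]

lemma sharp_eq {ν : TDual 𝔱} {X : 𝔱} (h : ∀ H : 𝔱, -killingForm ℝ (LieAlg E K) X H = ν H) :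
    sharp ν = X := by
  rw [← sharp_flat X]
  congr 1
  exact (LinearMap.ext h).symm

lemma sharp_add (ν ν' : TDual 𝔱) : sharp (ν + ν') = sharp ν + sharp ν' := by
  apply flat_injective
  rw [map_add, flat_sharp, flat_sharp, flat_sharp]

lemma sharp_smul (c : ℝ) (ν : TDual 𝔱) : sharp (c • ν) = c • sharp ν := by
  apply flat_injective
  rw [map_smul, flat_sharp, flat_sharp]

lemma ip_eq (ν ν' : TDual 𝔱) :
    ip ν ν' = -killingForm ℝ (LieAlg E K) (sharp ν : 𝔱) (sharp ν' : 𝔱) := by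
  rw [killingForm, LieModule.traceForm_comm, ← killingForm, killingForm_sharp, neg_neg, ip]

lemma ip_comm (ν ν' : TDual 𝔱) : ip ν ν' = ip ν' ν := by
  rw [ip_eq, ip_eq, killingForm, LieModule.traceForm_comm]

lemma ip_self_pos {ν : TDual 𝔱} (h : ν ≠ 0) : 0 < ip ν ν := by
  rw [ip_eq, neg_pos]
  refine killingForm_self_neg fun h0 => h ?_
  have h1 : sharp ν = 0 := Subtype.ext h0
  rw [← flat_sharp ν, h1, map_zero]

lemma ip_add_left (ν ν' α : TDual 𝔱) : ip (ν + ν') α = ip ν α + ip ν' α := by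
  rw [ip, sharp_add, map_add]; rfl

lemma ip_smul_left (c : ℝ) (ν α : TDual 𝔱) : ip (c • ν) α = c * ip ν α := by
  rw [ip, sharp_smul, map_smul]; rfl

lemma ip_neg_right (α ν : TDual 𝔱) : ip α (-ν) = -ip α ν := rfl

lemma sharp_coact {w : 𝔱 ≃ₗ[ℝ] 𝔱} (hw : w ∈ weylGroup 𝔱) (ν : TDual 𝔱) :
    sharp (coact w ν) = w (sharp ν) := by
  obtain ⟨k, hk⟩ := hw
  refine sharp_eq fun H => ?_
  rw [coact_apply, hk, ← killingForm_Ad k⁻¹, Ad_inv_Ad, ← weylGroup_symm_apply hk,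
    killingForm_sharp, neg_neg]

lemma ip_coact {w : 𝔱 ≃ₗ[ℝ] 𝔱} (hw : w ∈ weylGroup 𝔱) (ν ν' : TDual 𝔱) :
    ip (coact w ν) (coact w ν') = ip ν ν' := by
  rw [ip, sharp_coact hw, coact_apply, w.symm_apply_apply, ip]

lemma incl_coact {w : 𝔱 ≃ₗ[ℝ] 𝔱} {k : K}
    (hk : ∀ H : 𝔱, ((w H : 𝔱) : LieAlg E K) = Ad E k H) (ν : TDual 𝔱) (ξ : LieAlg E K) :
    incl (coact w ν) ξ = incl ν (Ad E k⁻¹ ξ) := by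
  rw [incl, incl, sharp_coact ⟨k, hk⟩, hk, LinearMap.neg_apply, LinearMap.neg_apply,
    ← killingForm_Ad k⁻¹, Ad_inv_Ad]

/-- The sum `𝔱 + ℝX` is an abelian subalgebra, so maximality absorbs `X`. -/
lemma IsCartan.mem_of_lie_eq_zero (h𝔱 : IsCartan 𝔱) {X : LieAlg E K}
    (hX : ∀ H : 𝔱, ⁅(H : LieAlg E K), X⁆ = 0) : X ∈ 𝔱 := by
  have hab : ∀ H H' : 𝔱, ⁅(H : LieAlg E K), (H' : LieAlg E K)⁆ = 0 := fun H H' =>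
    congrArg Subtype.val (h𝔱.1.trivial H H')
  have hzero : ∀ Y Y' : LieAlg E K, Y ∈ (𝔱 : Submodule ℝ (LieAlg E K)) ⊔ Submodule.span ℝ {X} →
      Y' ∈ (𝔱 : Submodule ℝ (LieAlg E K)) ⊔ Submodule.span ℝ {X} → ⁅Y, Y'⁆ = 0 := by
    intro Y Y' hY hY'
    obtain ⟨H, hH, _, hc, rfl⟩ := Submodule.mem_sup.1 hY
    obtain ⟨c, rfl⟩ := Submodule.mem_span_singleton.1 hc
    obtain ⟨H', hH', _, hc', rfl⟩ := Submodule.mem_sup.1 hY'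
    obtain ⟨c', rfl⟩ := Submodule.mem_span_singleton.1 hc'
    have h1 := hab ⟨H, hH⟩ ⟨H', hH'⟩
    have h2 := hX ⟨H, hH⟩
    have h3 := hX ⟨H', hH'⟩
    rw [← lie_skew, neg_eq_zero] at h3
    simp only at h1 h2 h3
    simp [h1, h2, h3]
  let 𝔰 : LieSubalgebra ℝ (LieAlg E K) :=
    { (𝔱 : Submodule ℝ (LieAlg E K)) ⊔ Submodule.span ℝ {X} with
      lie_mem' := fun {Y Y'} hY hY' => by
        rw [hzero Y Y' hY hY']
        exact Submodule.zero_mem _ }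
  have hle : 𝔱 ≤ 𝔰 := fun Y hY => Submodule.mem_sup_left hY
  refine h𝔱.2 (y := 𝔰) ⟨fun Y Y' => Subtype.ext (hzero Y Y' Y.2 Y'.2)⟩ hle ?_
  exact Submodule.mem_sup_right (Submodule.mem_span_singleton_self X)

/-- The bracket `[A, B]` centralizes `𝔱`, hence lies in it, and invariance of the Killing form makes
it a negative multiple of `sharp α`. Thus `ad A` rotates the plane of `[A, B]` and `B` and kills
`ker α`; take the half turn. -/
lemma exists_Ad_neg_sharp (h𝔱 : IsCartan 𝔱) {α : TDual 𝔱} (hα : IsRoot α) :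
    ∃ k : K, Ad E k (sharp α : 𝔱) = -(sharp α : 𝔱) ∧ ∀ H : 𝔱, α H = 0 → Ad E k H = H := by
  obtain ⟨h0, A, B, hAB, h⟩ := isRoot_iff.1 hα
  set κ := killingForm ℝ (LieAlg E K)
  have hinv : ∀ X Y Z : LieAlg E K, κ ⁅X, Y⁆ Z = κ X ⁅Y, Z⁆ :=
    LieModule.traceForm_apply_lie_apply ℝ (LieAlg E K) (LieAlg E K)
  have hCmem : ⁅A, B⁆ ∈ 𝔱 := h𝔱.mem_of_lie_eq_zero fun H => by
    rw [leibniz_lie, (h H).1, (h H).2]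
    simp
  have hCA : ∀ H : 𝔱, κ ⁅A, B⁆ H = -(α H * κ A A) := fun H => by
    rw [hinv, ← lie_skew, (h H).2, map_neg, map_smul, smul_eq_mul]
  have hCB : ∀ H : 𝔱, κ ⁅A, B⁆ H = -(α H * κ B B) := fun H => by
    rw [← lie_skew, map_neg, LinearMap.neg_apply, hinv, ← lie_skew, (h H).1]
    simp
  obtain ⟨H₀, hH₀⟩ : ∃ H, α H ≠ 0 := by
    by_contra hc
    exact h0 (LinearMap.ext fun H => not_not.1 (not_exists.1 hc H))
  have hAB' : κ A A = κ B B := by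
    have := (hCA H₀).symm.trans (hCB H₀)
    exact mul_left_cancel₀ hH₀ (neg_injective this)
  have ha : κ A A < 0 := by
    rcases hAB with hA | hB
    · exact killingForm_self_neg hA
    · rw [hAB']; exact killingForm_self_neg hB
  have hC : (⟨⁅A, B⁆, hCmem⟩ : 𝔱) = (κ A A) • sharp α := by
    rw [← sharp_smul]
    refine (sharp_eq fun H => ?_).symm
    change -κ ⁅A, B⁆ H = _
    rw [hCA, neg_neg, mul_comm]; rfl
  have hC' : ⁅A, B⁆ = (κ A A) • ((sharp α : 𝔱) : LieAlg E K) := congrArg Subtype.val hC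
  have hαC : α ⟨⁅A, B⁆, hCmem⟩ = κ A A * ip α α := by
    rw [hC, map_smul, smul_eq_mul, ip]
  obtain ⟨k, hk, hk'⟩ := exists_Ad_neg (X := A) (B := B) (C := ⁅A, B⁆) (c := -κ A A * ip α α)
    (mul_pos (neg_pos.2 ha) (ip_self_pos h0)) (by
      have h1 := (h ⟨⁅A, B⁆, hCmem⟩).1
      rw [hαC, ← lie_skew, neg_inj] at h1
      rw [h1]
      simp) rfl
  refine ⟨k, ?_, fun H hH => hk' _ ?_⟩
  · rw [hC', Ad_smul, ← smul_neg] at hk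
    exact smul_right_injective _ ha.ne hk
  · rw [← lie_skew, (h H).1, hH]
    simp

/-- The reflection in a root belongs to the Weyl group. -/
lemma exists_weylGroup_coact_eq_refl (h𝔱 : IsCartan 𝔱) {α : TDual 𝔱} (hα : IsRoot α) :
    ∃ w ∈ weylGroup 𝔱, ∀ ν, coact w ν = refl α ν := by
  obtain ⟨k, hk, hk'⟩ := exists_Ad_neg_sharp h𝔱 hα
  have hpos := ip_self_pos hα.1
  have h2 : ((2 / ip α α) • α) (sharp α) = 2 := by
    rw [LinearMap.smul_apply, smul_eq_mul]
    exact div_mul_cancel₀ 2 hpos.ne'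
  -- Both this reflection and `Ad k` negate `sharp α` and fix `ker α`, and these together span `𝔱`.
  refine ⟨Module.reflection h2, ⟨k, fun H => ?_⟩, fun ν => LinearMap.ext fun H => ?_⟩
  · rw [Module.reflection_apply]
    have hker : α (H - (α H / ip α α) • sharp α) = 0 := by
      have : α (sharp α) = ip α α := rfl
      rw [map_sub, map_smul, this, smul_eq_mul, div_mul_cancel₀ _ hpos.ne', sub_self]
    have hH : (H : LieAlg E K) = ((H - (α H / ip α α) • sharp α : 𝔱) : LieAlg E K) +
        (α H / ip α α) • ((sharp α : 𝔱) : LieAlg E K) := by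
      simp
    have h3 : Ad E k H = ((H - (α H / ip α α) • sharp α : 𝔱) : LieAlg E K) -
        (α H / ip α α) • ((sharp α : 𝔱) : LieAlg E K) := by
      conv_lhs => rw [hH]
      rw [Ad_add, Ad_smul, hk' _ hker, hk, smul_neg]
      exact (sub_eq_add_neg _ _).symm
    rw [h3]
    simp only [LinearMap.smul_apply, smul_eq_mul, AddSubgroupClass.coe_sub, SetLike.val_smul]
    module
  · rw [coact_apply, Module.reflection_symm, Module.reflection_apply, refl, ip_comm ν α]
    simp only [LinearMap.smul_apply, LinearMap.sub_apply, map_sub, map_smul, smul_eq_mul, ip]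
    ring

end Roots

variable {V : Type*} [NormedAddCommGroup V] [InnerProductSpace ℂ V] [FiniteDimensional ℂ V]
variable {𝔱 : LieSubalgebra ℝ (LieAlg E K)}

/-! ### Equivariance of the derived representation and of the momentum map -/

section Momentum

lemma rep_inv_apply (ρ : Representation ℂ K V) (k : K) (v : V) : ρ k⁻¹ (ρ k v) = v := by
  rw [← Module.End.mul_apply, ← map_mul, inv_mul_cancel, map_one, Module.End.one_apply]

/-- Differentiate `ρ (k g k⁻¹) = ρ k ∘ ρ g ∘ ρ k⁻¹` at `g = 1`. -/
lemma dRep_Ad {ρ : Representation ℂ K V} (hρ : IsUnitaryRep E ρ) (k : K) (ξ : LieAlg E K) (v : V) :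
    dRep E ρ (Ad E k ξ) (ρ k v) = ρ k (dRep E ρ ξ v) := by
  let Φ : (V →L[ℂ] V) →L[ℝ] (V →L[ℂ] V) :=
    (ContinuousLinearMap.compL ℂ V V V (repOp ρ k) ∘L
      (ContinuousLinearMap.compL ℂ V V V).flip (repOp ρ k⁻¹)).restrictScalars ℝ
  have hd : MDifferentiable 𝓘(ℝ, E) 𝓘(ℝ, V →L[ℂ] V) (repOp ρ) :=
    hρ.smooth.mdifferentiable (by simp)
  have hcomp : repOp ρ ∘ (fun g : K => k * g * k⁻¹) = Φ ∘ repOp ρ := by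
    funext g
    refine ContinuousLinearMap.ext fun u => ?_
    change ρ (k * g * k⁻¹) u = ρ k (ρ g (ρ k⁻¹ u))
    rw [map_mul, map_mul]; rfl
  let D : K → E →L[ℝ] (V →L[ℂ] V) := fun z => mfderiv 𝓘(ℝ, E) 𝓘(ℝ, V →L[ℂ] V) (repOp ρ) z
  have h1 : (mfderiv 𝓘(ℝ, E) 𝓘(ℝ, V →L[ℂ] V) (repOp ρ ∘ fun g : K => k * g * k⁻¹) 1 :
      E →L[ℝ] (V →L[ℂ] V)) = D (k * 1 * k⁻¹) ∘L adOp E k :=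
    mfderiv_comp 1 (hd _) (mdifferentiable_conj k 1)
  have h2 : (mfderiv 𝓘(ℝ, E) 𝓘(ℝ, V →L[ℂ] V) (Φ ∘ repOp ρ) 1 :
      E →L[ℝ] (V →L[ℂ] V)) = Φ ∘L D 1 :=
    (HasMFDerivAt.comp 1 (Φ.hasMFDerivAt) (hd 1).hasMFDerivAt).mfderiv
  rw [hcomp, h2, mul_one, mul_inv_cancel] at h1
  have h3 := congrArg (fun f : E →L[ℝ] (V →L[ℂ] V) => f ξ (ρ k v)) h1
  refine h3.symm.trans ?_
  change ρ k (dRep E ρ ξ (ρ k⁻¹ (ρ k v))) = _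
  rw [rep_inv_apply]

lemma dRep_rep {ρ : Representation ℂ K V} (hρ : IsUnitaryRep E ρ) (k : K) (ξ : LieAlg E K)
    (v : V) : dRep E ρ ξ (ρ k v) = ρ k (dRep E ρ (Ad E k⁻¹ ξ) v) := by
  rw [← dRep_Ad hρ, Ad_Ad_inv]

lemma rep_ne_zero (ρ : Representation ℂ K V) (k : K) {v : V} (hv : v ≠ 0) : ρ k v ≠ 0 := fun h =>
  hv (by rw [← rep_inv_apply ρ k v, h, map_zero])

lemma momentumVec_rep {ρ : Representation ℂ K V} (hρ : IsUnitaryRep E ρ) (k : K) (v : V)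
    (ξ : LieAlg E K) : momentumVec E ρ (ρ k v) ξ = momentumVec E ρ v (Ad E k⁻¹ ξ) := by
  change (1 / Complex.I * (inner ℂ (ρ k v) (dRep E ρ ξ (ρ k v)) / inner ℂ (ρ k v) (ρ k v))).re
    = (1 / Complex.I * (inner ℂ v (dRep E ρ (Ad E k⁻¹ ξ) v) / inner ℂ v v)).re
  rw [dRep_rep hρ, hρ.unitary, hρ.unitary]

lemma IsWeight.coact {ρ : Representation ℂ K V} (hρ : IsUnitaryRep E ρ) {w : 𝔱 ≃ₗ[ℝ] 𝔱}
    (hw : w ∈ weylGroup 𝔱) {ν : TDual 𝔱} (hν : IsWeight ρ ν) : IsWeight ρ (coact w ν) := by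
  obtain ⟨k, hk⟩ := hw
  obtain ⟨v, hv, h⟩ := hν
  refine ⟨ρ k v, rep_ne_zero ρ k hv, fun H => ?_⟩
  rw [dRep_rep hρ, ← weylGroup_symm_apply hk, h, map_smul, coact_apply]

variable [T2Space K] [CompactSpace K] [LieAlgebra.IsSemisimple ℝ (LieAlg E K)]

/-- If `k` represents `w`, replace `[v]` by `[ρ k v]`: both `μ` and `incl` are equivariant. -/
lemma incl_coact_mem_range_momentum {ρ : Representation ℂ K V} (hρ : IsUnitaryRep E ρ)
    {w : 𝔱 ≃ₗ[ℝ] 𝔱} (hw : w ∈ weylGroup 𝔱) {ν : TDual 𝔱}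
    (hν : incl ν ∈ Set.range (momentum E ρ)) : incl (coact w ν) ∈ Set.range (momentum E ρ) := by
  obtain ⟨k, hk⟩ := hw
  obtain ⟨p, hp⟩ := hν
  induction p using Projectivization.ind with
  | h v hv =>
    refine ⟨Projectivization.mk ℂ (ρ k v) (rep_ne_zero ρ k hv), LinearMap.ext fun ξ => ?_⟩
    rw [incl_coact hk, ← hp]
    exact momentumVec_rep hρ k v ξ

end Momentum

/-! ### Dominance of `λ` and the convexity of `W_λ 𝔱⁺` -/

section Chamber

/-- Evaluation at `H₀` is the height function: it detects the sign of a multiple of a simple root.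
-/
lemma IsSimpleSystem.exists_eval_eq_one {S : Set (TDual 𝔱)} (hS : IsSimpleSystem S) :
    ∃ H₀ : 𝔱, ∀ β ∈ S, β H₀ = 1 := by
  let b := Module.Basis.extend hS.linearIndependent
  obtain ⟨H₀, hH₀⟩ := (Module.evalEquiv ℝ 𝔱).surjective (b.constr ℝ fun _ => (1 : ℝ))
  refine ⟨H₀, fun β hβ => ?_⟩
  have h1 : b ⟨β, hS.linearIndependent.subset_extend _ hβ⟩ = β :=
    Module.Basis.extend_apply_self _ _
  have h2 := LinearMap.congr_fun hH₀ (b ⟨β, hS.linearIndependent.subset_extend _ hβ⟩)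
  rw [Module.Basis.constr_basis, h1] at h2
  exact h2

lemma apply_nonneg_of_mem_closure {S : Set (TDual 𝔱)} {H : 𝔱} (hH : ∀ β ∈ S, 0 ≤ β H)
    {x : TDual 𝔱} (hx : x ∈ AddSubmonoid.closure S) : 0 ≤ x H := by
  induction hx using AddSubmonoid.closure_induction with
  | mem x hx => exact hH x hx
  | zero => exact le_rfl
  | add x y _ _ h h' => exact add_nonneg h h'

lemma mul_mem_weylStab {lam : TDual 𝔱} {w w' : 𝔱 ≃ₗ[ℝ] 𝔱} (hw : w ∈ weylStab lam)
    (hw' : w' ∈ weylStab lam) : w * w' ∈ weylStab lam :=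
  ⟨mul_mem hw.1 hw'.1, by rw [coact_mul, hw'.2, hw.2]⟩

lemma inv_mem_weylStab {lam : TDual 𝔱} {w : 𝔱 ≃ₗ[ℝ] 𝔱} (hw : w ∈ weylStab lam) :
    w⁻¹ ∈ weylStab lam :=
  ⟨inv_mem hw.1, by conv_lhs => rw [← hw.2, coact_inv_coact]⟩

variable [T2Space K] [CompactSpace K] [LieAlgebra.IsSemisimple ℝ (LieAlg E K)]

/-- The reflected `s_β λ` is again a weight, so `λ - s_β λ`, a multiple of `β`, is a sum of simple
roots, and its coefficient is nonnegative. -/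
lemma highestWeight_mem_chamber (h𝔱 : IsCartan 𝔱) {S : Set (TDual 𝔱)} (hS : IsSimpleSystem S)
    {ρ : Representation ℂ K V} (hρ : IsUnitaryRep E ρ) {lam : TDual 𝔱}
    (hlam : IsHighestWeight ρ S lam) : lam ∈ chamber S := by
  intro β hβ
  obtain ⟨w, hw, hwβ⟩ := exists_weylGroup_coact_eq_refl h𝔱 (hS.isRoot β hβ)
  obtain ⟨H₀, hH₀⟩ := hS.exists_eval_eq_one
  have h1 := hlam.2 _ (hlam.1.coact hρ hw)
  rw [hwβ, refl, sub_sub_cancel] at h1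
  have h2 := apply_nonneg_of_mem_closure (H := H₀) (fun β hβ => by rw [hH₀ β hβ]; norm_num) h1
  rw [LinearMap.smul_apply, hH₀ β hβ, smul_eq_mul, mul_one] at h2
  have h3 := ip_self_pos (hS.isRoot β hβ).1
  have h4 := mul_nonneg h2 h3.le
  rw [div_mul_cancel₀ _ h3.ne'] at h4
  linarith

lemma mem_weylStab_iff {lam : TDual 𝔱} {w : 𝔱 ≃ₗ[ℝ] 𝔱} :
    w ∈ weylStab lam ↔ w ∈ weylGroup 𝔱 ∧ w (sharp lam) = sharp lam := by
  refine and_congr_right fun hw => ⟨fun h => ?_, fun h => ?_⟩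
  · rw [← sharp_coact hw, h]
  · rw [← flat_sharp (coact w lam), sharp_coact hw, h, flat_sharp]

/-- On the compact group `W_λ`, evaluation of `w ν` at a point attains a maximum. -/
lemma exists_weylStab_max (lam ν : TDual 𝔱) (H₀ : 𝔱) :
    ∃ w ∈ weylStab lam, ∀ w' ∈ weylStab lam, coact w' ν H₀ ≤ coact w ν H₀ := by
  -- The elements of `K` that represent `W_λ`. The conditions are closed, so compactness of `K`
  -- replaces finiteness of the Weyl group.
  let A : Set K := {k | (∀ H : 𝔱, Ad E k H ∈ 𝔱) ∧
    Ad E k (sharp lam : 𝔱) = ((sharp lam : 𝔱) : LieAlg E K)}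
  let f : K → ℝ := fun k => -killingForm ℝ (LieAlg E K) H₀ (Ad E k (sharp ν : 𝔱))
  have hAd : ∀ X : E, Continuous fun k : K => adOp E k X := fun X =>
    continuous_adOp.clm_apply continuous_const
  have hf : Continuous f := by
    let φ : E →ₗ[ℝ] ℝ := killingForm ℝ (LieAlg E K) H₀
    exact ((LinearMap.continuous_of_finiteDimensional φ).comp (hAd _)).neg
  have hA : IsCompact A := by
    let T : Submodule ℝ E := (𝔱 : Submodule ℝ (LieAlg E K))
    have hT : IsClosed (T : Set E) := T.closed_of_finiteDimensional
    have h1 : IsClosed {k : K | ∀ H : 𝔱, Ad E k H ∈ 𝔱} := by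
      rw [Set.ofPred_forall]
      exact isClosed_iInter fun H => hT.preimage (hAd ((H : LieAlg E K)))
    have h2 : ∀ X : E, IsClosed {k : K | adOp E k X = X} := fun X =>
      isClosed_eq (hAd X) continuous_const
    exact (h1.inter (h2 ((sharp lam : 𝔱) : LieAlg E K))).isCompact
  have hne : A.Nonempty := ⟨1, fun H => by rw [Ad_one]; exact H.2, Ad_one _⟩
  obtain ⟨k, hk, hmax⟩ := hA.exists_isMaxOn hne hf.continuousOn
  let g : 𝔱 →ₗ[ℝ] 𝔱 := (adEquiv E k).toLinearEquiv.toLinearMap.restrict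
    (p := (𝔱 : Submodule ℝ (LieAlg E K))) (q := (𝔱 : Submodule ℝ (LieAlg E K)))
    (fun H hH => hk.1 ⟨H, hH⟩)
  have hg : ∀ H : 𝔱, ((g H : 𝔱) : LieAlg E K) = Ad E k H := fun _ => rfl
  have hginj : Function.Injective g := fun H H' h => by
    have h1 := congrArg (fun H : 𝔱 => (H : LieAlg E K)) h
    simp only [hg] at h1
    exact Subtype.ext ((adEquiv E k).injective h1)
  have hval : ∀ (w : 𝔱 ≃ₗ[ℝ] 𝔱) (k : K), (∀ H : 𝔱, ((w H : 𝔱) : LieAlg E K) = Ad E k H) →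
      coact w ν H₀ = f k := by
    intro w k hw
    rw [← flat_sharp (coact w ν), sharp_coact ⟨k, hw⟩, flat_apply, hw, killingForm,
      LieModule.traceForm_comm]
  refine ⟨LinearEquiv.ofInjectiveEndo g hginj, mem_weylStab_iff.2 ⟨⟨k, hg⟩, Subtype.ext hk.2⟩,
    fun w' hw' => ?_⟩
  obtain ⟨⟨k', hk'⟩, hlam'⟩ := mem_weylStab_iff.1 hw'
  rw [hval w' k' hk', hval _ k hg]
  refine hmax ⟨fun H => ?_, ?_⟩
  · rw [← hk']; exact (w' H).2
  · rw [← hk', hlam']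

/-- The set `W_λ 𝔱⁺` is cut out by the roots that are positive on `lam`. -/
lemma mem_stabChamber_iff (h𝔱 : IsCartan 𝔱) {S : Set (TDual 𝔱)} (hS : IsSimpleSystem S)
    {lam : TDual 𝔱} (hlam : lam ∈ chamber S) {ν : TDual 𝔱} :
    ν ∈ stabChamber S lam ↔ ∀ α, IsRoot α → 0 < ip lam α → 0 ≤ ip ν α := by
  constructor
  · rintro ⟨w, hw, ν', hν', rfl⟩ α hα hpos
    have hw' := inv_mem_weylStab hw
    rw [← ip_coact hw'.1, coact_inv_coact]
    rw [← ip_coact hw'.1, hw'.2] at hpos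
    -- The root `w⁻¹ α` is still positive on `λ`; as `λ` is dominant, it cannot be a negative root.
    rcases hS.pos_or_neg _ (hα.coact hw'.1) with h | h
    · exact apply_nonneg_of_mem_closure hν' h
    · have := apply_nonneg_of_mem_closure hlam h
      change 0 ≤ ip lam _ at this
      rw [ip_neg_right] at this
      linarith
  · intro h
    obtain ⟨H₀, hH₀⟩ := hS.exists_eval_eq_one
    obtain ⟨w, hw, hmax⟩ := exists_weylStab_max lam ν H₀
    refine ⟨w⁻¹, inv_mem_weylStab hw, coact w ν, fun β hβ => ?_, (coact_inv_coact w ν).symm⟩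
    have hβr := hS.isRoot β hβ
    rcases (hlam β hβ).lt_or_eq with hpos | hzero
    · have h1 := h (coact w⁻¹ β) (hβr.coact (inv_mem hw.1)) (by
        rwa [← ip_coact hw.1, coact_coact_inv, hw.2])
      rwa [← ip_coact hw.1, coact_coact_inv] at h1
    -- Now `β` is orthogonal to `λ`, so `s_β ∈ W_λ`. Applying it changes the height of `wν` by
    -- `-2(wν|β)/(β|β)`, which maximality forces to be nonpositive.
    · obtain ⟨s, hs, hsβ⟩ := exists_weylGroup_coact_eq_refl h𝔱 hβr
      have hs' : s ∈ weylStab lam := ⟨hs, by rw [hsβ, refl, ← hzero]; simp⟩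
      have h1 := hmax _ (mul_mem_weylStab hs' hw)
      rw [coact_mul, hsβ, refl, LinearMap.sub_apply, LinearMap.smul_apply, hH₀ β hβ, smul_eq_mul,
        mul_one] at h1
      have h2 := ip_self_pos hβr.1
      have h3 : 0 ≤ 2 * ip (coact w ν) β / ip β β := by linarith
      have h4 := mul_nonneg h3 h2.le
      rw [div_mul_cancel₀ _ h2.ne'] at h4
      linarith

lemma convex_stabChamber (h𝔱 : IsCartan 𝔱) {S : Set (TDual 𝔱)} (hS : IsSimpleSystem S)
    {lam : TDual 𝔱} (hlam : lam ∈ chamber S) : Convex ℝ (stabChamber S lam) := by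
  intro x hx y hy a b ha hb _
  rw [mem_stabChamber_iff h𝔱 hS hlam] at hx hy ⊢
  intro α hα hpos
  rw [ip_add_left, ip_smul_left, ip_smul_left]
  exact add_nonneg (mul_nonneg ha (hx α hα hpos)) (mul_nonneg hb (hy α hα hpos))

end Chamber

/-! ### Convexity and `W_λ`-invariance of `Υ_λ` -/

section Upsilon

lemma convex_coneAt {M : Type*} [AddCommGroup M] [Module ℝ M] (a : M) (A : Set M) :
    Convex ℝ (coneAt a A) := by
  intro x hx y hy c d hc hd hcd
  have h : c • x + d • y - a = (⟨c, hc⟩ : {r : ℝ // 0 ≤ r}) • (x - a) +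
      (⟨d, hd⟩ : {r : ℝ // 0 ≤ r}) • (y - a) := by
    change _ = c • (x - a) + d • (y - a)
    have : a = (c + d) • a := by rw [hcd, one_smul]
    conv_lhs => rw [this]
    module
  change c • x + d • y - a ∈ PointedCone.hull ℝ ((fun y => y - a) '' A)
  rw [h]
  exact Submodule.add_mem (PointedCone.hull ℝ ((fun y => y - a) '' A))
    (Submodule.smul_mem _ _ hx) (Submodule.smul_mem _ _ hy)

/-- Since `w` fixes the vertex, it sends the generator `w'λ - λ` to `ww'λ - λ`. -/
lemma coact_mem_coneAt {lam ν : TDual 𝔱} {w : 𝔱 ≃ₗ[ℝ] 𝔱} (hw : w ∈ weylStab lam)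
    (hν : ν ∈ coneAt lam (weylOrbit lam)) : coact w ν ∈ coneAt lam (weylOrbit lam) := by
  have h : ∀ x ∈ PointedCone.hull ℝ ((fun y => y - lam) '' weylOrbit lam),
      coact w x ∈ PointedCone.hull ℝ ((fun y => y - lam) '' weylOrbit lam) := by
    intro x hx
    induction hx using Submodule.span_induction with
    | mem x hx =>
      obtain ⟨_, ⟨w', hw', rfl⟩, rfl⟩ := hx
      refine Submodule.subset_span ⟨coact (w * w') lam, ⟨_, mul_mem hw.1 hw', rfl⟩, ?_⟩
      change _ = coact w (coact w' lam) - coact w lam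
      rw [hw.2, coact_mul]
    | zero => exact Submodule.zero_mem _
    | add x y _ _ hx hy => exact add_mem hx hy
    | smul c x _ hx => exact Submodule.smul_mem _ c hx
  have h1 := h _ hν
  change coact w ν - coact w lam ∈ _ at h1
  rwa [hw.2] at h1

variable [T2Space K] [CompactSpace K] [LieAlgebra.IsSemisimple ℝ (LieAlg E K)]

lemma convex_upsilon (S : Set (TDual 𝔱)) (lam χ₀ : TDual 𝔱) : Convex ℝ (upsilon S lam χ₀) := by
  intro x hx y hy a b ha hb hab
  refine ⟨convex_coneAt _ _ hx.1 hy.1 ha hb hab, fun α hα h1 w hw => ?_⟩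
  rw [ip_add_left, ip_smul_left, ip_smul_left]
  have e1 := mul_le_mul_of_nonneg_left (hx.2 α hα h1 w hw) ha
  have e2 := mul_le_mul_of_nonneg_left (hy.2 α hα h1 w hw) hb
  calc _ ≤ (a + b) * ip lam (coact w (refl α χ₀)) := by linarith
    _ = _ := by rw [hab, one_mul]

lemma coact_mem_upsilon {S : Set (TDual 𝔱)} {lam χ₀ ν : TDual 𝔱} {w : 𝔱 ≃ₗ[ℝ] 𝔱}
    (hw : w ∈ weylStab lam) (hν : ν ∈ upsilon S lam χ₀) : coact w ν ∈ upsilon S lam χ₀ := by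
  refine ⟨coact_mem_coneAt hw hν.1, fun α hα h1 w' hw' => ?_⟩
  have hi := inv_mem_weylStab hw
  -- The inequality for `w'` at `wν` is the one for `w⁻¹w'` at `ν`, as `w` is an isometry fixing
  -- `λ`.
  have h := hν.2 α hα h1 _ (mul_mem_weylStab hi hw')
  rw [← ip_coact hw.1, ← ip_coact hw.1 lam, hw.2, ← coact_mul w, mul_inv_cancel_left] at h
  exact h

lemma incl_apply_coe (ν : TDual 𝔱) (H : 𝔱) : incl ν (H : LieAlg E K) = ν H := by
  rw [incl, LinearMap.neg_apply, killingForm_sharp, neg_neg]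

lemma incl_injective : Function.Injective (incl : TDual 𝔱 → Module.Dual ℝ (LieAlg E K)) :=
  fun ν ν' h => LinearMap.ext fun H => by rw [← incl_apply_coe, h, incl_apply_coe]

lemma convex_image_incl {s : Set (TDual 𝔱)} (hs : Convex ℝ s) : Convex ℝ (incl '' s) := by
  refine hs.is_linear_image ⟨fun ν ν' => ?_, fun c ν => ?_⟩
  · rw [incl, sharp_add, Submodule.coe_add, map_add, neg_add]; rfl
  · rw [incl, sharp_smul, Submodule.coe_smul, map_smul]
    exact (smul_neg c _).symm

end Upsilon

end MomentumCone

end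

/-! ### Transport of the equality from `𝔱⁺` to `W_λ 𝔱⁺` -/

theorem mainTheorem6
    {E : Type*} [NormedAddCommGroup E] [NormedSpace ℝ E] [FiniteDimensional ℝ E]
    -- the compact connected semisimple Lie group
    {K : Type*} [TopologicalSpace K] [ChartedSpace E K] [Group K] [LieGroup 𝓘(ℝ, E) ∞ K]
    [T2Space K] [CompactSpace K] [ConnectedSpace K]
    [LieAlgebra.IsSemisimple ℝ (MomentumCone.LieAlg E K)]
    -- the Cartan subalgebra and the simple roots
    (𝔱 : LieSubalgebra ℝ (MomentumCone.LieAlg E K)) (h𝔱 : MomentumCone.IsCartan 𝔱)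
    (S : Set (MomentumCone.TDual 𝔱)) (hS : MomentumCone.IsSimpleSystem S)
    -- the irreducible unitary representation with highest weight `lam`
    {V : Type*} [NormedAddCommGroup V] [InnerProductSpace ℂ V] [FiniteDimensional ℂ V]
    (ρ : Representation ℂ K V) [ρ.IsIrreducible] (hρ : MomentumCone.IsUnitaryRep E ρ)
    (lam : MomentumCone.TDual 𝔱) (hlam : MomentumCone.IsHighestWeight ρ S lam)
    (χ₀ : MomentumCone.TDual 𝔱) (hχ₀ : MomentumCone.IsChiZero S lam χ₀)
    (hμ : Set.range (MomentumCone.momentum E ρ) ∩ MomentumCone.incl '' MomentumCone.chamber S =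
      MomentumCone.incl '' (MomentumCone.upsilon S lam χ₀ ∩ MomentumCone.chamber S)) :
    Set.range (MomentumCone.momentum E ρ) ∩ MomentumCone.incl '' MomentumCone.stabChamber S lam =
        MomentumCone.incl ''
          (MomentumCone.upsilon S lam χ₀ ∩ MomentumCone.stabChamber S lam) ∧
      Convex ℝ (Set.range (MomentumCone.momentum E ρ) ∩
        MomentumCone.incl '' MomentumCone.stabChamber S lam) := by
  open MomentumCone in
  have hdom := highestWeight_mem_chamber h𝔱 hS hρ hlam
  have heq : Set.range (momentum E ρ) ∩ incl '' stabChamber S lam =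
      incl '' (upsilon S lam χ₀ ∩ stabChamber S lam) := by
    apply Set.Subset.antisymm
    · rintro _ ⟨hr, _, ⟨w, hw, ν, hν, rfl⟩, rfl⟩
      -- Move the point back into `𝔱⁺` by `w⁻¹`, use the known equality there, and return by `w`.
      have h1 := incl_coact_mem_range_momentum hρ (inv_mem hw.1) hr
      rw [coact_inv_coact] at h1
      obtain ⟨ν', hν', he⟩ := hμ.subset ⟨h1, ν, hν, rfl⟩
      obtain rfl := incl_injective he
      exact ⟨_, ⟨coact_mem_upsilon hw hν'.1, w, hw, _, hν, rfl⟩, rfl⟩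
    · rintro _ ⟨_, ⟨hu, w, hw, ν, hν, rfl⟩, rfl⟩
      have h1 := coact_mem_upsilon (inv_mem_weylStab hw) hu
      rw [coact_inv_coact] at h1
      have h2 := (hμ.superset ⟨ν, ⟨h1, hν⟩, rfl⟩).1
      exact ⟨incl_coact_mem_range_momentum hρ hw.1 h2, _, ⟨w, hw, ν, hν, rfl⟩, rfl⟩
  exact ⟨heq, heq ▸ convex_image_incl
    ((convex_upsilon S lam χ₀).inter (convex_stabChamber h𝔱 hS hdom))⟩
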